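/- Let $\Lambda=\mathbb{Q}[m,l^{\pm1}]$ with field of fractions $F$, put $\tau=\frac{l-l^{-1}}{m}+1\in F$, and let $n\ge 1$. Let $R$ be any ring with $\Lambda\subseteq R\subseteq F$ and $\tau\in R$ (for example $R=\Lambda[\tau]$, the smallest such ring, or $R=\mathbb{Q}[m^{\pm1},l^{\pm1}]$). Write $[ab\dots]_k$ for the alternating product of length $k$ starting with $a$, and $[\dots ab]_k$ for the alternating product of length $k$ ending with $b$. Let $\bar B_R$ be the associative unital $R$-algebra generated by $X_0^{\pm1},X_1^{\pm1},E_0,E_1$ subject to the relations 1. $[X_0X_1\dots]_{2n+1}=[X_1X_0\dots]_{2n+1}$; 2. $X_i-X_i^{-1}=m(E_i-1)$ for $i=0,1$; 3. $X_iE_i=E_iX_i=lE_i$ for $i=0,1$; 4. $E_i^2=\tau E_i$ for $i=0,1$; 5. $E_0[X_1X_0\dots]_{2i-1}E_0=l^{-1}E_0$ for $1\le i\le n$; 6. $E_1[X_0X_1\dots]_{2i-1}E_1=l^{-1}E_1$ for $1\le i\le n$; 7. $E_0[X_1^{-1}X_0^{-1}\dots]_{2i-1}E_0=lE_0$ for $1\le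 i\le n$; 8. $E_1[X_0^{-1}X_1^{-1}\dots]_{2i-1}E_1=lE_1$ for $1\le i\le n$; 9. $[X_0X_1\dots]_{2n}E_0=E_1[X_0X_1\dots]_{2n}$; 10. $E_0[X_1X_0\dots]_{2n}=[X_1X_0\dots]_{2n}E_1$. Let $B$ be the $F$-algebra with the same presentation. In $B$ consider the family $\Sigma$ consisting of the elements $[X_1X_0\dots]_i$ ($0\le i\le 2n$), $[X_0X_1\dots]_j$ ($1\le j\le 2n+1$) and $[\dots X_0X_1]_aE_0[X_1X_0\dots]_b$ ($0\le a,b\le 2n$), and let $A_n\subseteq B$ be its $R$-linear span. Then: (a) $\Sigma$ is an $F$-basis of $B$, and the structure constants of $B$ with respect to $\Sigma$ all lie in $R$. (b) $A_n$ is an $R$-subalgebra of $B$, and there is an isomorphism of $R$-algebras $\bar B_R\to A_n$ which sends each generator $X_i^{\pm1},E_i$ of $\bar B_R$ to the generator of $B$ with the same name. (c) Consequently $\bar B_R$ is a free $R$-module of finite rank $2(2n+1)+(2n+1)^2$. -/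

import Mathlib

open scoped LaurentPolynomial Polynomial

noncomputable section

namespace DihedralBMW

/-- The alternating product `[a b a …]_k` of length `k` that starts with `a`. -/
def altFrom {A : Type*} [Monoid A] (a b : A) : ℕ → A
  | 0 => 1
  | k + 1 => a * altFrom b a k

/-- The alternating product `[… b a b]_k` of length `k` that ends with `b`. -/
def altTo {A : Type*} [Monoid A] (a b : A) : ℕ → A
  | 0 => 1
  | k + 1 => altTo b a k * b

/-- Symbols for the generators: `X i` is `X_i`, `Xinv i` is its inverse, `E i` is `E_i`. -/
inductive Gen : Type
  | X (i : Fin 2)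
  | Xinv (i : Fin 2)
  | E (i : Fin 2)

section Presentation

variable (R : Type*) [CommRing R]

/-- The generator `X_i` in the free algebra. -/
abbrev fX (i : Fin 2) : FreeAlgebra R Gen := FreeAlgebra.ι R (Gen.X i)

/-- The generator `X_i⁻¹` in the free algebra. -/
abbrev fXinv (i : Fin 2) : FreeAlgebra R Gen := FreeAlgebra.ι R (Gen.Xinv i)

/-- The generator `E_i` in the free algebra. -/
abbrev fE (i : Fin 2) : FreeAlgebra R Gen := FreeAlgebra.ι R (Gen.E i)

/-- The defining relations of the BMW type algebra of type `I₂(2n+1)` with parameters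
`m`, `l` (invertible) and `τ`. -/
inductive Rel (m : R) (l : Rˣ) (τ : R) (n : ℕ) :
    FreeAlgebra R Gen → FreeAlgebra R Gen → Prop
  | X_mul_Xinv (i : Fin 2) : Rel m l τ n (fX R i * fXinv R i) 1
  | Xinv_mul_X (i : Fin 2) : Rel m l τ n (fXinv R i * fX R i) 1
  | braid : Rel m l τ n (altFrom (fX R 0) (fX R 1) (2 * n + 1))
      (altFrom (fX R 1) (fX R 0) (2 * n + 1))
  | skein (i : Fin 2) : Rel m l τ n (fX R i - fXinv R i) (m • (fE R i - 1))
  | X_mul_E (i : Fin 2) : Rel m l τ n (fX R i * fE R i) ((l : R) • fE R i)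
  | E_mul_X (i : Fin 2) : Rel m l τ n (fE R i * fX R i) ((l : R) • fE R i)
  | E_mul_E (i : Fin 2) : Rel m l τ n (fE R i * fE R i) (τ • fE R i)
  | E₀_X_E₀ (i : ℕ) (h1 : 1 ≤ i) (hn : i ≤ n) :
      Rel m l τ n (fE R 0 * altFrom (fX R 1) (fX R 0) (2 * i - 1) * fE R 0)
        (((l⁻¹ : Rˣ) : R) • fE R 0)
  | E₁_X_E₁ (i : ℕ) (h1 : 1 ≤ i) (hn : i ≤ n) :
      Rel m l τ n (fE R 1 * altFrom (fX R 0) (fX R 1) (2 * i - 1) * fE R 1)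
        (((l⁻¹ : Rˣ) : R) • fE R 1)
  | E₀_Xinv_E₀ (i : ℕ) (h1 : 1 ≤ i) (hn : i ≤ n) :
      Rel m l τ n (fE R 0 * altFrom (fXinv R 1) (fXinv R 0) (2 * i - 1) * fE R 0)
        ((l : R) • fE R 0)
  | E₁_Xinv_E₁ (i : ℕ) (h1 : 1 ≤ i) (hn : i ≤ n) :
      Rel m l τ n (fE R 1 * altFrom (fXinv R 0) (fXinv R 1) (2 * i - 1) * fE R 1)
        ((l : R) • fE R 1)
  | slide_E₀ : Rel m l τ n (altFrom (fX R 0) (fX R 1) (2 * n) * fE R 0)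
      (fE R 1 * altFrom (fX R 0) (fX R 1) (2 * n))
  | slide_E₁ : Rel m l τ n (fE R 0 * altFrom (fX R 1) (fX R 0) (2 * n))
      (altFrom (fX R 1) (fX R 0) (2 * n) * fE R 1)

end Presentation

/-- The `R`-algebra presented by the generators `X_i^{±1}`, `E_i` (`i = 0, 1`) and the relations
of type `I₂(2n+1)` with parameters `m`, `l`, `τ` in `R`. -/
abbrev BMW (R : Type*) [CommRing R] (m : R) (l : Rˣ) (τ : R) (n : ℕ) : Type _ :=
  RingQuot (Rel R m l τ n)

/-- The image of a generator in the presented algebra. -/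
def gen {R : Type*} [CommRing R] (m : R) (l : Rˣ) (τ : R) (n : ℕ) (g : Gen) : BMW R m l τ n :=
  RingQuot.mkAlgHom R (Rel R m l τ n) (FreeAlgebra.ι R g)

/-- The ring `Λ = ℚ[m, l^{±1}]`; the polynomial variable is `m`, the Laurent variable is `l`. -/
abbrev Lam : Type := ℚ[X][T;T⁻¹]

/-- The variable `m` of `Λ`. -/
def mLam : Lam := LaurentPolynomial.C Polynomial.X

/-- The variable `l` of `Λ`, a unit with inverse `l⁻¹`. -/
def lLam : Lamˣ where
  val := LaurentPolynomial.T 1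
  inv := LaurentPolynomial.T (-1)
  val_inv := by rw [← LaurentPolynomial.T_add]; simp
  inv_val := by rw [← LaurentPolynomial.T_add]; simp

/-- The field of fractions `F_Λ` of `Λ`. -/
abbrev FLam : Type := FractionRing Lam

/-- `τ = (l - l⁻¹) / m + 1`, an element of `F_Λ`. -/
def tau : FLam :=
  (algebraMap Lam FLam (lLam : Lam) - algebraMap Lam FLam ((lLam⁻¹ : Lamˣ) : Lam)) /
    algebraMap Lam FLam mLam + 1

/-- The algebra `B_{I₂(2n+1)}(m, l)` over the field `F_Λ`. -/
abbrev B (n : ℕ) : Type :=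
  BMW FLam (algebraMap Lam FLam mLam) (Units.map (algebraMap Lam FLam) lLam) tau n

/-- The generators of `B_{I₂(2n+1)}(m, l)`. -/
def bGen (n : ℕ) (g : Gen) : B n := gen _ _ _ n g

/-- The integral form `B̄_{I₂(2n+1)}(m, l)`: the same presentation over a ring `R` of
coefficients with `Λ ⊆ R ⊆ F_Λ` and `τ ∈ R`. -/
abbrev BBar (R : Subalgebra Lam FLam) (hτ : tau ∈ R) (n : ℕ) : Type :=
  BMW R (algebraMap Lam R mLam) (Units.map (algebraMap Lam R) lLam) ⟨tau, hτ⟩ n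

/-- The generators of the integral form. -/
def bBarGen (R : Subalgebra Lam FLam) (hτ : tau ∈ R) (n : ℕ) (g : Gen) : BBar R hτ n :=
  gen _ _ _ n g

/-- Indices of the family `Σ = Σ₂ ∪ Σ₁`. -/
abbrev SigmaIdx (n : ℕ) : Type :=
  (Fin (2 * n + 1) ⊕ Fin (2 * n + 1)) ⊕ (Fin (2 * n + 1) × Fin (2 * n + 1))

/-- The family `Σ`: the words `[X₁X₀…]_i` (`0 ≤ i ≤ 2n`) and `[X₀X₁…]_j` (`1 ≤ j ≤ 2n+1`)
of `Σ₂`, and the elements `[…X₀X₁]_a E₀ [X₁X₀…]_b` (`0 ≤ a, b ≤ 2n`) of `Σ₁`. -/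
def sigma (n : ℕ) : SigmaIdx n → B n
  | Sum.inl (Sum.inl i) => altFrom (bGen n (Gen.X 1)) (bGen n (Gen.X 0)) i
  | Sum.inl (Sum.inr j) => altFrom (bGen n (Gen.X 0)) (bGen n (Gen.X 1)) (j + 1)
  | Sum.inr (a, b) =>
      altTo (bGen n (Gen.X 0)) (bGen n (Gen.X 1)) a * bGen n (Gen.E 0) *
        altFrom (bGen n (Gen.X 1)) (bGen n (Gen.X 0)) b

/-- `A_n`, the span of `Σ` over the ring `R` of coefficients. -/
def An (R : Subalgebra Lam FLam) (n : ℕ) : Submodule R (B n) :=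
  Submodule.span R (Set.range (sigma n))

end DihedralBMW

end

/-! Everything reduces to two facts: `Σ` spans the presented algebra over every coefficient ring,
and `Σ` is linearly independent over the field.

Spanning (`span_sigmaOf_gen_eq_top`). The span of `Σ` contains `1`, so it suffices that left
multiplication by each generator preserves it. Since `X_i² = 1 - m X_i + m l E_i`, multiplying an
alternating word by a letter gives alternating words plus elements with a factor `E_i`. Those fall
into the two-sided cell spanned by the `[…X₀X₁]_a E₀ [X₁X₀…]_b`, because `E₁` is conjugate to `E₀`
and every sandwich of an alternating word between two `E₀` is a multiple of `E₀`. Inverses need no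
separate treatment: the skein relation expresses them through `X_i`, `E_i` and `1`. The argument
uses no property of the parameters.

Independence (`linearIndependent_sigmaOf`). Two representations separate the two halves of `Σ`.
Setting `E_i = 0` gives the Hecke algebra of the dihedral group; its regular module, written out on
`2(2n+1)` basis vectors, kills the elements containing `E₀` and sends the words, applied to the
vector `1`, to the standard basis. For the remaining elements there is a cell module of rank `2n+1`
with a pairing whose Gram matrix `G` has `τ` on the diagonal and `1`, `l`, `l⁻¹` elsewhere. If `G`
is invertible, the images of these `(2n+1)²` elements span all endomorphisms, hence are independent
by counting dimensions. Invertibility is generic: `m G` has entries in `Λ`, and at `m = 0`, `l = 2`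
it becomes `3/2` times the identity.

Descent. The natural `R`-algebra map from the integral form to `B` carries a spanning family to the
independent family `Σ`. So that family is a basis, the map is injective with image `A_n`, and since
the image is closed under products the structure constants lie in `R`. -/

noncomputable section

namespace DihedralBMW

/-! ### Alternating words in a monoid. -/

section Alternating

variable {A : Type*} [Monoid A]

theorem altFrom_succ (a b : A) (k : ℕ) : altFrom a b (k + 1) = a * altFrom b a k := rfl

theorem altTo_succ (a b : A) (k : ℕ) : altTo a b (k + 1) = altTo b a k * b := rfl

theorem altFrom_even_succ (a b : A) (k : ℕ) :
    altFrom a b (2 * k + 1) = altFrom a b (2 * k) * a ∧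
      altFrom a b (2 * k + 2) = altFrom a b (2 * k + 1) * b := by
  induction k generalizing a b with
  | zero => simp [altFrom]
  | succ k ih =>
    have h := ih a b
    constructor
    · rw [show 2 * (k + 1) + 1 = (2 * k + 1) + 1 + 1 by ring, altFrom_succ, altFrom_succ, h.1,
        show 2 * (k + 1) = (2 * k) + 1 + 1 by ring, altFrom_succ, altFrom_succ]
      simp only [mul_assoc]
    · have e : altFrom a b (2 * (k + 1) + 1) = a * (b * altFrom a b (2 * k + 1)) := rfl
      rw [e, show 2 * (k + 1) + 2 = (2 * k + 2) + 1 + 1 by ring, altFrom_succ, altFrom_succ, h.2]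
      simp only [mul_assoc]

theorem altFrom_odd (a b : A) (k : ℕ) : altFrom a b (2 * k + 1) = altFrom a b (2 * k) * a :=
  (altFrom_even_succ a b k).1

theorem altFrom_even (a b : A) (k : ℕ) :
    altFrom a b (2 * k + 2) = altFrom a b (2 * k + 1) * b :=
  (altFrom_even_succ a b k).2

theorem altTo_eq_altFrom (a b : A) (k : ℕ) :
    altTo a b (2 * k) = altFrom a b (2 * k) ∧ altTo b a (2 * k + 1) = altFrom a b (2 * k + 1) := by
  induction k with
  | zero => simp [altFrom, altTo]
  | succ k ih =>
    have h : altTo a b (2 * (k + 1)) = altFrom a b (2 * (k + 1)) := by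
      rw [show 2 * (k + 1) = (2 * k + 1) + 1 by ring, altTo_succ, ih.2, altFrom_even]
    exact ⟨h, by rw [altTo_succ, h, altFrom_odd]⟩

theorem altTo_even_eq (a b : A) (k : ℕ) : altTo a b (2 * k) = altFrom a b (2 * k) :=
  (altTo_eq_altFrom a b k).1

theorem altTo_odd_eq (a b : A) (k : ℕ) : altTo a b (2 * k + 1) = altFrom b a (2 * k + 1) :=
  (altTo_eq_altFrom b a k).2

theorem altTo_odd (a b : A) (k : ℕ) : altTo a b (2 * k + 1) = b * altTo a b (2 * k) := by
  rw [altTo_odd_eq, altFrom_succ, altTo_even_eq]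

theorem altTo_even (a b : A) (k : ℕ) : altTo a b (2 * k + 2) = a * altTo a b (2 * k + 1) := by
  rw [altTo_odd_eq, show 2 * k + 2 = 2 * (k + 1) by ring, altTo_even_eq, ← altFrom_succ]
  rfl

theorem map_altFrom {C F : Type*} [Monoid C] [FunLike F A C] [MonoidHomClass F A C] (f : F)
    (a b : A) (k : ℕ) : f (altFrom a b k) = altFrom (f a) (f b) k := by
  induction k generalizing a b with
  | zero => simp [altFrom]
  | succ k ih => simp [altFrom, ih]

theorem map_altTo {C F : Type*} [Monoid C] [FunLike F A C] [MonoidHomClass F A C] (f : F)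
    (a b : A) (k : ℕ) : f (altTo a b k) = altTo (f a) (f b) k := by
  induction k generalizing a b with
  | zero => simp [altTo]
  | succ k ih => simp [altTo, ih]

theorem op_altFrom (a b : A) (k : ℕ) :
    MulOpposite.op (altFrom a b k) = altTo (MulOpposite.op b) (MulOpposite.op a) k := by
  induction k generalizing a b with
  | zero => simp [altFrom, altTo]
  | succ k ih => simp [altFrom, altTo, ih]

theorem altTo_mul_altFrom {x y x' y' : A} (hx : x * x' = 1) (hy : y * y' = 1) (k : ℕ) :
    altTo x y k * altFrom y' x' k = 1 := by
  induction k generalizing x y x' y' with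
  | zero => simp [altFrom, altTo]
  | succ k ih =>
    rw [altTo_succ, altFrom_succ, mul_assoc, ← mul_assoc y, hy, one_mul, ih hy hx]

/-- Inverse letters cancel from the inside outwards. The case `j = 0` says that the two words of
length `2 * k` are inverse to each other. -/
theorem altFrom_add_mul_altFrom {x y x' y' : A} (hx : x' * x = 1) (hy : y' * y = 1) (j k : ℕ) :
    altFrom y' x' (2 * (j + k)) * altFrom x y (2 * k) = altFrom y' x' (2 * j) := by
  induction k with
  | zero => simp [altFrom]
  | succ k ih =>
    rw [show 2 * (j + (k + 1)) = 2 * (j + k) + 2 by ring, altFrom_even, altFrom_odd,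
      show 2 * (k + 1) = 2 * k + 1 + 1 by ring, altFrom_succ, altFrom_succ, mul_assoc,
      ← mul_assoc x', hx, one_mul, mul_assoc, ← mul_assoc y', hy, one_mul, ih]

theorem semiconj_altFrom {d a b a' b' : A} (ha : d * a = a' * d) (hb : d * b = b' * d) (k : ℕ) :
    d * altFrom a b k = altFrom a' b' k * d := by
  induction k generalizing a b a' b' with
  | zero => simp [altFrom]
  | succ k ih => rw [altFrom_succ, ← mul_assoc, ha, mul_assoc, ih hb ha, altFrom_succ, mul_assoc]

end Alternating

/-- A triple of families of elements of an algebra satisfying the defining relations of `BMW`. -/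
structure Satisfies {R A : Type*} [CommRing R] [Ring A] [Algebra R A] (m : R) (l : Rˣ) (τ : R)
    (n : ℕ) (x y e : Fin 2 → A) : Prop where
  x_mul_y (i : Fin 2) : x i * y i = 1
  y_mul_x (i : Fin 2) : y i * x i = 1
  braid : altFrom (x 0) (x 1) (2 * n + 1) = altFrom (x 1) (x 0) (2 * n + 1)
  skein (i : Fin 2) : x i - y i = m • (e i - 1)
  x_mul_e (i : Fin 2) : x i * e i = (l : R) • e i
  e_mul_x (i : Fin 2) : e i * x i = (l : R) • e i
  e_mul_e (i : Fin 2) : e i * e i = τ • e i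
  e₀_x_e₀ (i : ℕ) (h1 : 1 ≤ i) (hn : i ≤ n) :
    e 0 * altFrom (x 1) (x 0) (2 * i - 1) * e 0 = ((l⁻¹ : Rˣ) : R) • e 0
  e₁_x_e₁ (i : ℕ) (h1 : 1 ≤ i) (hn : i ≤ n) :
    e 1 * altFrom (x 0) (x 1) (2 * i - 1) * e 1 = ((l⁻¹ : Rˣ) : R) • e 1
  e₀_y_e₀ (i : ℕ) (h1 : 1 ≤ i) (hn : i ≤ n) :
    e 0 * altFrom (y 1) (y 0) (2 * i - 1) * e 0 = (l : R) • e 0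
  e₁_y_e₁ (i : ℕ) (h1 : 1 ≤ i) (hn : i ≤ n) :
    e 1 * altFrom (y 0) (y 1) (2 * i - 1) * e 1 = (l : R) • e 1
  slide_e₀ : altFrom (x 0) (x 1) (2 * n) * e 0 = e 1 * altFrom (x 0) (x 1) (2 * n)
  slide_e₁ : e 0 * altFrom (x 1) (x 0) (2 * n) = altFrom (x 1) (x 0) (2 * n) * e 1

/-! ### The universal property of the presentation, change of scalars and reversal. -/

section Generators

variable {R A : Type*} [CommRing R] [Ring A] [Algebra R A] (m : R) (l : Rˣ) (τ : R) (n : ℕ)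

theorem satisfies_gen : Satisfies m l τ n (fun i => gen m l τ n (Gen.X i))
    (fun i => gen m l τ n (Gen.Xinv i)) (fun i => gen m l τ n (Gen.E i)) := by
  have key : ∀ {a b}, Rel R m l τ n a b →
      RingQuot.mkAlgHom R (Rel R m l τ n) a = RingQuot.mkAlgHom R (Rel R m l τ n) b :=
    fun h => RingQuot.mkAlgHom_rel R h
  constructor
  · intro i; simpa [gen] using key (Rel.X_mul_Xinv i)
  · intro i; simpa [gen] using key (Rel.Xinv_mul_X i)
  · simpa only [gen, map_altFrom] using key Rel.braid
  · intro i; simpa [gen] using key (Rel.skein i)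
  · intro i; simpa only [gen, map_mul, map_smul] using key (Rel.X_mul_E i)
  · intro i; simpa only [gen, map_mul, map_smul] using key (Rel.E_mul_X i)
  · intro i; simpa only [gen, map_mul, map_smul] using key (Rel.E_mul_E i)
  · intro i h1 hn
    simpa only [gen, map_mul, map_smul, map_altFrom] using key (Rel.E₀_X_E₀ i h1 hn)
  · intro i h1 hn
    simpa only [gen, map_mul, map_smul, map_altFrom] using key (Rel.E₁_X_E₁ i h1 hn)
  · intro i h1 hn
    simpa only [gen, map_mul, map_smul, map_altFrom] using key (Rel.E₀_Xinv_E₀ i h1 hn)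
  · intro i h1 hn
    simpa only [gen, map_mul, map_smul, map_altFrom] using key (Rel.E₁_Xinv_E₁ i h1 hn)
  · simpa only [gen, map_mul, map_altFrom] using key Rel.slide_E₀
  · simpa only [gen, map_mul, map_altFrom] using key Rel.slide_E₁

/-- The value on a generator prescribed by a triple of families. -/
def genValue (x y e : Fin 2 → A) : Gen → A
  | Gen.X i => x i
  | Gen.Xinv i => y i
  | Gen.E i => e i

variable {m l τ n}

/-- The universal property of `BMW`. -/
theorem Satisfies.exists_algHom {x y e : Fin 2 → A} (h : Satisfies m l τ n x y e) :
    ∃ f : BMW R m l τ n →ₐ[R] A, ∀ g, f (gen m l τ n g) = genValue x y e g := by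
  refine ⟨RingQuot.liftAlgHom R ⟨FreeAlgebra.lift R (genValue x y e), ?_⟩, fun g => ?_⟩
  · intro a b hab
    cases hab
    · simpa [genValue] using h.x_mul_y _
    · simpa [genValue] using h.y_mul_x _
    · simpa [genValue, map_altFrom] using h.braid
    · simpa [genValue] using h.skein _
    · simpa only [map_mul, map_smul, FreeAlgebra.lift_ι_apply, genValue] using h.x_mul_e _
    · simpa only [map_mul, map_smul, FreeAlgebra.lift_ι_apply, genValue] using h.e_mul_x _
    · simpa only [map_mul, map_smul, FreeAlgebra.lift_ι_apply, genValue] using h.e_mul_e _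
    · simpa only [map_mul, map_smul, map_altFrom, FreeAlgebra.lift_ι_apply, genValue]
        using h.e₀_x_e₀ _ ‹_› ‹_›
    · simpa only [map_mul, map_smul, map_altFrom, FreeAlgebra.lift_ι_apply, genValue]
        using h.e₁_x_e₁ _ ‹_› ‹_›
    · simpa only [map_mul, map_smul, map_altFrom, FreeAlgebra.lift_ι_apply, genValue]
        using h.e₀_y_e₀ _ ‹_› ‹_›
    · simpa only [map_mul, map_smul, map_altFrom, FreeAlgebra.lift_ι_apply, genValue]
        using h.e₁_y_e₁ _ ‹_› ‹_›
    · simpa only [map_mul, map_altFrom, FreeAlgebra.lift_ι_apply, genValue] using h.slide_e₀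
    · simpa only [map_mul, map_altFrom, FreeAlgebra.lift_ι_apply, genValue] using h.slide_e₁
  · simp [gen]

/-- Restriction of scalars: it lets the algebra over the field receive a map from the presentation
over the smaller ring. -/
theorem Satisfies.map_smul_tower {S : Type*} [CommRing S] [Algebra S A] [Algebra S R]
    [IsScalarTower S R A] {m' : S} {l' : Sˣ} {τ' : S} {x y e : Fin 2 → A}
    (h : Satisfies (algebraMap S R m') (Units.map (algebraMap S R) l') (algebraMap S R τ') n x y e) :
    Satisfies m' l' τ' n x y e := by
  obtain ⟨h1, h2, h3, h4, h5, h6, h7, h8, h9, h10, h11, h12, h13⟩ := h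
  rw [← map_inv] at h8 h9
  simp only [Units.coe_map, MonoidHom.coe_coe, algebraMap_smul] at *
  exact ⟨h1, h2, h3, h4, h5, h6, h7, h8, h9, h10, h11, h12, h13⟩

/-- The presentation is invariant under reversing words: alternating words of odd length are
palindromes, and the two slide relations are exchanged. Right-handed statements thus follow from
left-handed ones. -/
theorem Satisfies.op {x y e : Fin 2 → A} (h : Satisfies m l τ n x y e) :
    Satisfies m l τ n (fun i => MulOpposite.op (x i)) (fun i => MulOpposite.op (y i))
      (fun i => MulOpposite.op (e i)) := by
  have hodd : ∀ (a b : A) {i : ℕ}, 1 ≤ i → altFrom (MulOpposite.op a) (MulOpposite.op b) (2 * i - 1) =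
      MulOpposite.op (altFrom a b (2 * i - 1)) := by
    intro a b i hi
    obtain ⟨k, rfl⟩ := Nat.exists_eq_add_of_le' hi
    rw [show 2 * (k + 1) - 1 = 2 * k + 1 by omega, op_altFrom, altTo_odd_eq]
  have heven : ∀ (a b : A) (i : ℕ), altFrom (MulOpposite.op a) (MulOpposite.op b) (2 * i) =
      MulOpposite.op (altFrom b a (2 * i)) := by
    intro a b i
    rw [op_altFrom, altTo_even_eq]
  constructor
  · intro i; rw [← MulOpposite.op_mul, h.y_mul_x, MulOpposite.op_one]
  · intro i; rw [← MulOpposite.op_mul, h.x_mul_y, MulOpposite.op_one]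
  · have h' := congrArg MulOpposite.op h.braid
    rwa [op_altFrom, op_altFrom, altTo_odd_eq, altTo_odd_eq] at h'
  · intro i; rw [← MulOpposite.op_sub, h.skein, MulOpposite.op_smul]; rfl
  · intro i; rw [← MulOpposite.op_mul, h.e_mul_x, MulOpposite.op_smul]
  · intro i; rw [← MulOpposite.op_mul, h.x_mul_e, MulOpposite.op_smul]
  · intro i; rw [← MulOpposite.op_mul, h.e_mul_e, MulOpposite.op_smul]
  · intro i h1 hn
    rw [hodd _ _ h1, ← MulOpposite.op_mul, ← MulOpposite.op_mul, ← mul_assoc, h.e₀_x_e₀ i h1 hn,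
      MulOpposite.op_smul]
  · intro i h1 hn
    rw [hodd _ _ h1, ← MulOpposite.op_mul, ← MulOpposite.op_mul, ← mul_assoc, h.e₁_x_e₁ i h1 hn,
      MulOpposite.op_smul]
  · intro i h1 hn
    rw [hodd _ _ h1, ← MulOpposite.op_mul, ← MulOpposite.op_mul, ← mul_assoc, h.e₀_y_e₀ i h1 hn,
      MulOpposite.op_smul]
  · intro i h1 hn
    rw [hodd _ _ h1, ← MulOpposite.op_mul, ← MulOpposite.op_mul, ← mul_assoc, h.e₁_y_e₁ i h1 hn,
      MulOpposite.op_smul]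
  · rw [heven, ← MulOpposite.op_mul, ← MulOpposite.op_mul, h.slide_e₁]
  · rw [heven, ← MulOpposite.op_mul, ← MulOpposite.op_mul, h.slide_e₀]

end Generators

/-! ### `Σ` spans the algebra over any commutative ring. -/

section Spanning


variable {R A : Type*} [CommRing R] [Ring A] [Algebra R A]

/-- The span of the elements `[… x₀ x₁]_a e₀` with `a ≤ 2n`. -/
def leftCell (R : Type*) {A : Type*} [CommRing R] [Ring A] [Algebra R A] (n : ℕ)
    (x e : Fin 2 → A) : Submodule R A :=
  Submodule.span R {z | ∃ a ≤ 2 * n, z = altTo (x 0) (x 1) a * e 0}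

/-- The span of the elements `e₀ [x₁ x₀ …]_b` with `b ≤ 2n`. -/
def rightCell (R : Type*) {A : Type*} [CommRing R] [Ring A] [Algebra R A] (n : ℕ)
    (x e : Fin 2 → A) : Submodule R A :=
  Submodule.span R {z | ∃ b ≤ 2 * n, z = e 0 * altFrom (x 1) (x 0) b}

/-- The span of the elements `[… x₀ x₁]_a e₀ [x₁ x₀ …]_b` with `a, b ≤ 2n`. -/
def twoSidedCell (R : Type*) {A : Type*} [CommRing R] [Ring A] [Algebra R A] (n : ℕ)
    (x e : Fin 2 → A) : Submodule R A :=
  Submodule.span R {z | ∃ a ≤ 2 * n, ∃ b ≤ 2 * n,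
    z = altTo (x 0) (x 1) a * e 0 * altFrom (x 1) (x 0) b}

/-- The family `Σ` attached to families of elements of an algebra. -/
def sigmaOf {A : Type*} [Monoid A] (n : ℕ) (x e : Fin 2 → A) : SigmaIdx n → A
  | Sum.inl (Sum.inl i) => altFrom (x 1) (x 0) i
  | Sum.inl (Sum.inr j) => altFrom (x 0) (x 1) (j + 1)
  | Sum.inr (a, b) => altTo (x 0) (x 1) a * e 0 * altFrom (x 1) (x 0) b

namespace Satisfies

variable {m : R} {l : Rˣ} {τ : R} {n : ℕ} {x y e : Fin 2 → A}

theorem inv_eq (h : Satisfies m l τ n x y e) (i : Fin 2) : y i = x i - m • e i + m • 1 := by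
  have := h.skein i
  rw [sub_eq_iff_eq_add] at this
  rw [this, smul_sub]; abel

theorem sq_mul (h : Satisfies m l τ n x y e) (i : Fin 2) (z : A) :
    x i * (x i * z) = z - m • (x i * z) + (m * l) • (e i * z) := by
  have h1 := h.x_mul_y i
  rw [h.inv_eq, mul_add, mul_sub, mul_smul_comm, mul_smul_comm, h.x_mul_e, mul_one, smul_smul] at h1
  have h2 : x i * x i = 1 - m • x i + (m * l) • e i := by rw [← h1]; abel
  rw [← mul_assoc, h2, add_mul, sub_mul, one_mul, smul_mul_assoc, smul_mul_assoc]

theorem y_mul_e (h : Satisfies m l τ n x y e) (i : Fin 2) :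
    y i * e i = ((l⁻¹ : Rˣ) : R) • e i := by
  have h1 : y i * (x i * e i) = e i := by rw [← mul_assoc, h.y_mul_x, one_mul]
  rw [h.x_mul_e, mul_smul_comm] at h1
  nth_rewrite 2 [← h1]
  rw [smul_smul, Units.inv_mul, one_smul]

/-- `e₁` is conjugate to `e₀`. -/
theorem e₁_eq (h : Satisfies m l τ n x y e) :
    e 1 = altFrom (x 0) (x 1) (2 * n) * e 0 * altFrom (y 1) (y 0) (2 * n) := by
  rw [h.slide_e₀, mul_assoc, ← altTo_even_eq, altTo_mul_altFrom (h.x_mul_y 0) (h.x_mul_y 1),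
    mul_one]

theorem exists_e₀_cell (h : Satisfies m l τ n x y e) {a : ℕ} (ha : a ≤ 2 * n) :
    ∃ c : R, e 0 * (altTo (x 0) (x 1) a * e 0) = c • e 0 := by
  obtain ⟨k, rfl | rfl⟩ := Nat.even_or_odd' a
  · rcases k with _ | k
    · exact ⟨τ, by simpa [altTo] using h.e_mul_e 0⟩
    -- A word of even length begins with `x 0`, which `e 0` absorbs with factor `l`; the odd word
    -- left over contributes `l⁻¹`.
    · refine ⟨l * ((l⁻¹ : Rˣ) : R), ?_⟩
      have := h.e₀_x_e₀ (k + 1) (by omega) (by omega)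
      rw [show 2 * (k + 1) - 1 = 2 * k + 1 by omega] at this
      rw [show 2 * (k + 1) = 2 * k + 2 by ring, altTo_even, altTo_odd_eq, mul_assoc (x 0),
        ← mul_assoc, h.e_mul_x, smul_mul_assoc, ← mul_assoc, this, smul_smul]
  · refine ⟨((l⁻¹ : Rˣ) : R), ?_⟩
    have := h.e₀_x_e₀ (k + 1) (by omega) (by omega)
    rw [show 2 * (k + 1) - 1 = 2 * k + 1 by omega] at this
    rw [altTo_odd_eq, ← mul_assoc, this]

/-- Writing `e 1 = w * e 0 * w⁻¹` with `w` the word of length `2 * n`, the factor `w⁻¹` cancels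
against the word of length `2 * k`. What is left between two `e 0` is a word in the inverses, of
length `2 * (n - k)`. -/
theorem exists_e₁_cell (h : Satisfies m l τ n x y e) {k : ℕ} (hk : k ≤ n) :
    ∃ c : R, e 1 * (altTo (x 0) (x 1) (2 * k) * e 0) = c • (altTo (x 0) (x 1) (2 * n) * e 0) := by
  obtain ⟨j, rfl⟩ := Nat.exists_eq_add_of_le' hk
  have key : ∃ c : R, e 0 * (altFrom (y 1) (y 0) (2 * j) * e 0) = c • e 0 := by
    rcases j with _ | j
    · exact ⟨τ, by simpa [altFrom] using h.e_mul_e 0⟩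
    · refine ⟨((l⁻¹ : Rˣ) : R) * l, ?_⟩
      have := h.e₀_y_e₀ (j + 1) (by omega) (by omega)
      rw [show 2 * (j + 1) - 1 = 2 * j + 1 by omega] at this
      rw [show 2 * (j + 1) = 2 * j + 2 by ring, altFrom_even, mul_assoc _ (y 0), h.y_mul_e,
        mul_smul_comm, mul_smul_comm, ← mul_assoc, this, smul_smul]
  obtain ⟨c, hc⟩ := key
  refine ⟨c, ?_⟩
  rw [h.e₁_eq, altTo_even_eq, altTo_even_eq, mul_assoc, ← mul_assoc _ (altFrom (x 0) (x 1) (2 * k)),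
    altFrom_add_mul_altFrom (h.y_mul_x 0) (h.y_mul_x 1), mul_assoc, hc, mul_smul_comm]

theorem mem_leftCell {a : ℕ} (ha : a ≤ 2 * n) :
    altTo (x 0) (x 1) a * e 0 ∈ leftCell R n x e :=
  Submodule.subset_span ⟨a, ha, rfl⟩

/-- A letter either lengthens the word or meets itself and is removed by the quadratic relation,
whose `e i` term is a multiple of one end of the chain. At the two ends the letter acts by the
scalar `l`. -/
theorem x_mul_mem_leftCell (h : Satisfies m l τ n x y e) (i : Fin 2) {z : A}
    (hz : z ∈ leftCell R n x e) : x i * z ∈ leftCell R n x e := by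
  suffices H : leftCell R n x e ≤ (leftCell R n x e).comap (LinearMap.mulLeft R (x i)) from H hz
  refine Submodule.span_le.2 ?_
  rintro _ ⟨a, ha, rfl⟩
  change x i * (altTo (x 0) (x 1) a * e 0) ∈ leftCell R n x e
  obtain ⟨k, rfl | rfl⟩ := Nat.even_or_odd' a
  · fin_cases i
    · change x 0 * _ ∈ _
      rcases k with _ | k
      · simp only [altTo, one_mul, h.x_mul_e]
        exact Submodule.smul_mem _ _ (by simpa [altTo] using mem_leftCell (Nat.zero_le (2 * n)))
      · rw [show 2 * (k + 1) = 2 * k + 2 by ring] at ha ⊢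
        obtain ⟨c, hc⟩ := h.exists_e₀_cell (a := 2 * k + 1) (by omega)
        rw [altTo_even, mul_assoc (x 0), h.sq_mul, hc, ← mul_assoc, ← altTo_even]
        refine Submodule.add_mem _ (Submodule.sub_mem _ (mem_leftCell (by omega))
          (Submodule.smul_mem _ _ (mem_leftCell ha))) (Submodule.smul_mem _ _
            (Submodule.smul_mem _ _ ?_))
        simpa [altTo] using mem_leftCell (Nat.zero_le (2 * n))
    · change x 1 * _ ∈ _
      rcases Nat.lt_or_ge k n with hk | hk
      · rw [← mul_assoc, ← altTo_odd]
        exact mem_leftCell (by omega)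
      · obtain rfl : k = n := by omega
        -- At full length the slide relation brings `e 1` to the front, where it absorbs `x 1`.
        rw [altTo_even_eq, h.slide_e₀, ← mul_assoc, h.x_mul_e, smul_mul_assoc, ← h.slide_e₀,
          ← altTo_even_eq]
        exact Submodule.smul_mem _ _ (mem_leftCell ha)
  · fin_cases i
    · change x 0 * _ ∈ _
      rw [← mul_assoc, ← altTo_even]
      exact mem_leftCell (by omega)
    · change x 1 * _ ∈ _
      obtain ⟨c, hc⟩ := h.exists_e₁_cell (k := k) (by omega)
      rw [altTo_odd, mul_assoc (x 1), h.sq_mul, hc, ← mul_assoc, ← altTo_odd]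
      exact Submodule.add_mem _ (Submodule.sub_mem _ (mem_leftCell (by omega))
          (Submodule.smul_mem _ _ (mem_leftCell ha))) (Submodule.smul_mem _ _
            (Submodule.smul_mem _ _ (mem_leftCell le_rfl)))

theorem e_mul_mem_leftCell (h : Satisfies m l τ n x y e) (i : Fin 2) {z : A}
    (hz : z ∈ leftCell R n x e) : e i * z ∈ leftCell R n x e := by
  suffices H : leftCell R n x e ≤ (leftCell R n x e).comap (LinearMap.mulLeft R (e i)) from H hz
  refine Submodule.span_le.2 ?_
  rintro _ ⟨a, ha, rfl⟩
  change e i * (altTo (x 0) (x 1) a * e 0) ∈ leftCell R n x e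
  fin_cases i
  · change e 0 * _ ∈ _
    obtain ⟨c, hc⟩ := h.exists_e₀_cell ha
    rw [hc]
    exact Submodule.smul_mem _ _ (by simpa [altTo] using mem_leftCell (Nat.zero_le (2 * n)))
  · change e 1 * _ ∈ _
    obtain ⟨k, rfl | rfl⟩ := Nat.even_or_odd' a
    · obtain ⟨c, hc⟩ := h.exists_e₁_cell (k := k) (by omega)
      rw [hc]
      exact Submodule.smul_mem _ _ (mem_leftCell le_rfl)
    · obtain ⟨c, hc⟩ := h.exists_e₁_cell (k := k) (by omega)
      rw [altTo_odd, mul_assoc (x 1), ← mul_assoc (e 1), h.e_mul_x, smul_mul_assoc, hc]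
      exact Submodule.smul_mem _ _ (Submodule.smul_mem _ _ (mem_leftCell le_rfl))

theorem y_mul_mem_of_closed (h : Satisfies m l τ n x y e) (i : Fin 2) {S : Submodule R A} {z : A}
    (hx : x i * z ∈ S) (he : e i * z ∈ S) (hz : z ∈ S) : y i * z ∈ S := by
  rw [h.inv_eq, add_mul, sub_mul, smul_mul_assoc, smul_mul_assoc, one_mul]
  exact S.add_mem (S.sub_mem hx (S.smul_mem _ he)) (S.smul_mem _ hz)

theorem op_mem_leftCell {z : A} :
    MulOpposite.op z ∈ leftCell R n (fun i => MulOpposite.op (x i)) (fun i => MulOpposite.op (e i)) ↔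
      z ∈ rightCell R n x e := by
  have : leftCell R n (fun i => MulOpposite.op (x i)) (fun i => MulOpposite.op (e i)) =
      (rightCell R n x e).map (MulOpposite.opLinearEquiv R : A ≃ₗ[R] Aᵐᵒᵖ).toLinearMap := by
    rw [leftCell, rightCell, Submodule.map_span]
    congr 1
    ext w
    constructor
    · rintro ⟨a, ha, rfl⟩
      exact ⟨_, ⟨a, ha, rfl⟩, by simp [op_altFrom]⟩
    · rintro ⟨_, ⟨a, ha, rfl⟩, rfl⟩
      exact ⟨a, ha, by simp [op_altFrom]⟩
  rw [this]
  constructor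
  · rintro ⟨w, hw, hwz⟩
    rwa [← MulOpposite.op_injective hwz]
  · intro hz
    exact ⟨z, hz, rfl⟩

theorem mul_x_mem_rightCell (h : Satisfies m l τ n x y e) (i : Fin 2) {z : A}
    (hz : z ∈ rightCell R n x e) : z * x i ∈ rightCell R n x e := by
  rw [← op_mem_leftCell] at hz ⊢
  exact h.op.x_mul_mem_leftCell i hz

theorem mul_y_mem_rightCell (h : Satisfies m l τ n x y e) (i : Fin 2) {z : A}
    (hz : z ∈ rightCell R n x e) : z * y i ∈ rightCell R n x e := by
  rw [← op_mem_leftCell] at hz ⊢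
  exact h.op.y_mul_mem_of_closed i (h.op.x_mul_mem_leftCell i hz) (h.op.e_mul_mem_leftCell i hz) hz

theorem mul_altFrom_mem {S : Submodule R A} {a b : A} (ha : ∀ z ∈ S, z * a ∈ S)
    (hb : ∀ z ∈ S, z * b ∈ S) (k : ℕ) {z : A} (hz : z ∈ S) : z * altFrom a b k ∈ S := by
  induction k generalizing z a b with
  | zero => simpa [altFrom] using hz
  | succ k ih => rw [altFrom_succ, ← mul_assoc]; exact ih hb ha (ha z hz)

theorem e₀_mem_rightCell : e 0 ∈ rightCell R n x e :=
  Submodule.subset_span ⟨0, Nat.zero_le _, by simp [altFrom]⟩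

theorem altTo_mul_mem_twoSidedCell {a : ℕ} (ha : a ≤ 2 * n) {z : A}
    (hz : z ∈ rightCell R n x e) : altTo (x 0) (x 1) a * z ∈ twoSidedCell R n x e := by
  suffices H : rightCell R n x e ≤
    (twoSidedCell R n x e).comap (LinearMap.mulLeft R (altTo (x 0) (x 1) a)) from H hz
  refine Submodule.span_le.2 ?_
  rintro _ ⟨b, hb, rfl⟩
  exact Submodule.subset_span ⟨a, ha, b, hb, by simp [mul_assoc]⟩

theorem mul_altFrom_mem_twoSidedCell {b : ℕ} (hb : b ≤ 2 * n) {z : A}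
    (hz : z ∈ leftCell R n x e) : z * altFrom (x 1) (x 0) b ∈ twoSidedCell R n x e := by
  suffices H : leftCell R n x e ≤
    (twoSidedCell R n x e).comap (LinearMap.mulRight R (altFrom (x 1) (x 0) b)) from H hz
  refine Submodule.span_le.2 ?_
  rintro _ ⟨a, ha, rfl⟩
  exact Submodule.subset_span ⟨a, ha, b, hb, by simp⟩

theorem mul_mem_twoSidedCell {t : A} (ht : ∀ z ∈ leftCell R n x e, t * z ∈ leftCell R n x e)
    {z : A} (hz : z ∈ twoSidedCell R n x e) : t * z ∈ twoSidedCell R n x e := by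
  suffices H : twoSidedCell R n x e ≤
    (twoSidedCell R n x e).comap (LinearMap.mulLeft R t) from H hz
  refine Submodule.span_le.2 ?_
  rintro _ ⟨a, ha, b, hb, rfl⟩
  change t * (altTo (x 0) (x 1) a * e 0 * altFrom (x 1) (x 0) b) ∈ twoSidedCell R n x e
  rw [← mul_assoc]
  exact mul_altFrom_mem_twoSidedCell hb (ht _ (mem_leftCell ha))

/-- The word needs no length bound: `e 0` lies in the right cell, which is stable under right
multiplication by all `x j` and `y j`, and `e 1` is a conjugate of `e 0`. -/
theorem e_mul_altFrom_mem (h : Satisfies m l τ n x y e) (i j j' : Fin 2) (k : ℕ) :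
    e i * altFrom (x j) (x j') k ∈ twoSidedCell R n x e := by
  have hx : ∀ j, ∀ z ∈ rightCell R n x e, z * x j ∈ rightCell R n x e :=
    fun j z hz => h.mul_x_mem_rightCell j hz
  have hy : ∀ j, ∀ z ∈ rightCell R n x e, z * y j ∈ rightCell R n x e :=
    fun j z hz => h.mul_y_mem_rightCell j hz
  fin_cases i
  · change e 0 * _ ∈ _
    simpa [altTo] using altTo_mul_mem_twoSidedCell (Nat.zero_le (2 * n))
      (mul_altFrom_mem (hx j) (hx j') k e₀_mem_rightCell)
  · change e 1 * _ ∈ _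
    rw [h.e₁_eq, ← altTo_even_eq, mul_assoc _ (e 0), mul_assoc]
    exact altTo_mul_mem_twoSidedCell le_rfl (mul_altFrom_mem (hx j) (hx j') k
      (mul_altFrom_mem (hy 1) (hy 0) (2 * n) e₀_mem_rightCell))

/-- The span of `Σ`. -/
theorem span_sigmaOf_eq (h : Satisfies m l τ n x y e) :
    Submodule.span R (Set.range (sigmaOf n x e)) =
      Submodule.span R {z | ∃ k ≤ 2 * n + 1, ∃ i j : Fin 2, i ≠ j ∧ z = altFrom (x i) (x j) k} ⊔
        twoSidedCell R n x e := by
  rw [twoSidedCell, ← Submodule.span_union]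
  refine congrArg _ (Set.Subset.antisymm ?_ ?_)
  · rintro _ ⟨(i | j) | ⟨a, b⟩, rfl⟩
    · exact Or.inl ⟨i, by omega, 1, 0, by decide, rfl⟩
    · exact Or.inl ⟨j + 1, by omega, 0, 1, by decide, rfl⟩
    · exact Or.inr ⟨a, by omega, b, by omega, rfl⟩
  · rintro _ (⟨k, hk, i, j, hij, rfl⟩ | ⟨a, ha, b, hb, rfl⟩)
    · have h10 : ∀ k ≤ 2 * n, altFrom (x 1) (x 0) k ∈ Set.range (sigmaOf n x e) :=
        fun k hk => ⟨Sum.inl (Sum.inl ⟨k, by omega⟩), rfl⟩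
      have h01 : ∀ k ≤ 2 * n, altFrom (x 0) (x 1) (k + 1) ∈ Set.range (sigmaOf n x e) :=
        fun k hk => ⟨Sum.inl (Sum.inr ⟨k, by omega⟩), rfl⟩
      fin_cases i <;> fin_cases j
      · exact absurd rfl hij
      · rcases k with _ | k
        · exact h10 0 (by omega)
        · exact h01 k (by omega)
      · rcases Nat.lt_or_ge (2 * n) k with hk' | hk'
        · obtain rfl : k = 2 * n + 1 := by omega
          change altFrom (x 1) (x 0) _ ∈ _
          rw [← h.braid]
          exact h01 _ le_rfl
        · exact h10 k hk'
      · exact absurd rfl hij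
    · exact ⟨Sum.inr (⟨a, by omega⟩, ⟨b, by omega⟩), rfl⟩

theorem e_mul_mem_span (h : Satisfies m l τ n x y e) (i : Fin 2) {z : A}
    (hz : z ∈ Submodule.span R (Set.range (sigmaOf n x e))) :
    e i * z ∈ Submodule.span R (Set.range (sigmaOf n x e)) := by
  rw [h.span_sigmaOf_eq] at hz ⊢
  obtain ⟨u, hu, v, hv, rfl⟩ := Submodule.mem_sup.1 hz
  rw [mul_add]
  refine Submodule.mem_sup_right (Submodule.add_mem _ ?_
    (mul_mem_twoSidedCell (fun _ => h.e_mul_mem_leftCell i) hv))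
  clear hv hz
  induction hu using Submodule.span_induction with
  | mem u hu =>
    obtain ⟨k, -, j, j', -, rfl⟩ := hu
    exact h.e_mul_altFrom_mem i j j' k
  | zero => simp
  | add u v _ _ hu hv =>
    rw [mul_add]
    exact Submodule.add_mem _ hu hv
  | smul c u _ hu =>
    rw [mul_smul_comm]
    exact Submodule.smul_mem _ _ hu

theorem x_mul_mem_span (h : Satisfies m l τ n x y e) (i : Fin 2) {z : A}
    (hz : z ∈ Submodule.span R (Set.range (sigmaOf n x e))) :
    x i * z ∈ Submodule.span R (Set.range (sigmaOf n x e)) := by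
  rw [h.span_sigmaOf_eq] at hz ⊢
  obtain ⟨u, hu, v, hv, rfl⟩ := Submodule.mem_sup.1 hz
  rw [mul_add]
  refine Submodule.add_mem _ ?_ (Submodule.mem_sup_right
    (mul_mem_twoSidedCell (fun _ => h.x_mul_mem_leftCell i) hv))
  clear hv hz
  induction hu using Submodule.span_induction with
  | mem u hu =>
    obtain ⟨k, hk, j, j', hj, rfl⟩ := hu
    have hword : ∀ k ≤ 2 * n + 1, ∀ i j : Fin 2, i ≠ j → altFrom (x i) (x j) k ∈
        Submodule.span R {z | ∃ k ≤ 2 * n + 1, ∃ i j : Fin 2, i ≠ j ∧ z = altFrom (x i) (x j) k} :=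
      fun k hk i j hij => Submodule.subset_span ⟨k, hk, i, j, hij, rfl⟩
    have hself : ∀ k ≤ 2 * n, ∀ j', i ≠ j' → x i * altFrom (x i) (x j') (k + 1) ∈
        Submodule.span R {z | ∃ k ≤ 2 * n + 1, ∃ i j : Fin 2, i ≠ j ∧ z = altFrom (x i) (x j) k} ⊔
          twoSidedCell R n x e := by
      intro k hk j' hij
      rw [altFrom_succ, h.sq_mul, ← altFrom_succ]
      exact Submodule.add_mem _ (Submodule.mem_sup_left (Submodule.sub_mem _
        (hword k (by omega) _ _ hij.symm)
          (Submodule.smul_mem _ _ (hword (k + 1) (by omega) _ _ hij))))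
        (Submodule.mem_sup_right (Submodule.smul_mem _ _ (h.e_mul_altFrom_mem _ _ _ _)))
    have hbraid : altFrom (x j) (x j') (2 * n + 1) = altFrom (x j') (x j) (2 * n + 1) := by
      have := h.braid
      fin_cases j <;> fin_cases j' <;> first | rfl | exact this | exact this.symm
    rcases eq_or_ne i j with rfl | hij
    · rcases k with _ | k
      · exact Submodule.mem_sup_left (hword 1 (by omega) i j' hj)
      · exact hself k (by omega) j' hj
    · obtain rfl : i = j' := by omega
      rcases Nat.lt_or_ge (2 * n) k with hk' | hk'
      · obtain rfl : k = 2 * n + 1 := by omega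
        -- The longest word can be made to start with either letter, so multiplication by `x i`
        -- never produces a longer one.
        rw [hbraid]
        exact hself _ le_rfl j hij
      · exact Submodule.mem_sup_left (hword (k + 1) (by omega) i j hij)
  | zero => simp
  | add u v _ _ hu hv =>
    rw [mul_add]
    exact Submodule.add_mem _ hu hv
  | smul c u _ hu =>
    rw [mul_smul_comm]
    exact Submodule.smul_mem _ _ hu

theorem one_mem_span : (1 : A) ∈ Submodule.span R (Set.range (sigmaOf n x e)) :=
  Submodule.subset_span ⟨Sum.inl (Sum.inl 0), rfl⟩

end Satisfies

/-- The span contains `1` and is stable under left multiplication by every generator, hence by the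
whole algebra. -/
theorem span_sigmaOf_gen_eq_top (m : R) (l : Rˣ) (τ : R) (n : ℕ) :
    Submodule.span R (Set.range (sigmaOf n (fun i => gen m l τ n (Gen.X i))
      (fun i => gen m l τ n (Gen.E i)))) = ⊤ := by
  have h := satisfies_gen m l τ n
  set S := Submodule.span R (Set.range (sigmaOf n (fun i => gen m l τ n (Gen.X i))
      (fun i => gen m l τ n (Gen.E i)))) with hS
  have key : ∀ p : FreeAlgebra R Gen, ∀ z ∈ S, RingQuot.mkAlgHom R (Rel R m l τ n) p * z ∈ S := by
    intro p
    induction p using FreeAlgebra.induction with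
    | grade0 r =>
      intro z hz
      rw [AlgHom.commutes, ← Algebra.smul_def]
      exact S.smul_mem _ hz
    | grade1 g =>
      intro z hz
      change gen m l τ n g * z ∈ S
      cases g with
      | X i => exact h.x_mul_mem_span i hz
      | Xinv i =>
        exact h.y_mul_mem_of_closed i (h.x_mul_mem_span i hz) (h.e_mul_mem_span i hz) hz
      | E i => exact h.e_mul_mem_span i hz
    | mul p q hp hq =>
      intro z hz
      rw [map_mul, mul_assoc]
      exact hp _ (hq _ hz)
    | add p q hp hq =>
      intro z hz
      rw [map_add, add_mul]
      exact S.add_mem (hp _ hz) (hq _ hz)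
  refine eq_top_iff.2 fun z _ => ?_
  obtain ⟨p, rfl⟩ := RingQuot.mkAlgHom_surjective R (Rel R m l τ n) z
  simpa using key p 1 Satisfies.one_mem_span

end Spanning

/-! ### Reducing the relations that a representation has to satisfy. -/

section Braid

variable {R A : Type*} [CommRing R] [Ring A] [Algebra R A] {m l : R}

/-- In the difference `D` of the two braid words, the quadratic relations create two `m * l` terms,
which the slide relation identifies. So `D * x₁` is a left multiple of `D`, and the kernel of `D` is
stable under `x₁`. -/
theorem braid_defect_mul {x₀ x₁ e₀ e₁ : A} {n : ℕ}
    (h₀ : x₀ * x₀ = 1 - m • x₀ + (m * l) • e₀) (h₁ : x₁ * x₁ = 1 - m • x₁ + (m * l) • e₁)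
    (hs : e₀ * altFrom x₁ x₀ (2 * n) = altFrom x₁ x₀ (2 * n) * e₁) :
    (altFrom x₀ x₁ (2 * n + 1) - altFrom x₁ x₀ (2 * n + 1)) * x₁ =
      -(x₀ + m • 1) * (altFrom x₀ x₁ (2 * n + 1) - altFrom x₁ x₀ (2 * n + 1)) := by
  have e1 : altFrom x₀ x₁ (2 * n + 1) * x₁ = x₀ * altFrom x₁ x₀ (2 * n + 1) := by
    rw [← altFrom_even, ← altFrom_succ]
  have e2 : altFrom x₁ x₀ (2 * n + 1) * x₁ = altFrom x₁ x₀ (2 * n)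
      - m • altFrom x₁ x₀ (2 * n + 1) + (m * l) • (altFrom x₁ x₀ (2 * n) * e₁) := by
    rw [altFrom_odd, mul_assoc, h₁, mul_add, mul_sub, mul_one, mul_smul_comm, mul_smul_comm]
  have e3 : x₀ * altFrom x₀ x₁ (2 * n + 1) = altFrom x₁ x₀ (2 * n)
      - m • altFrom x₀ x₁ (2 * n + 1) + (m * l) • (e₀ * altFrom x₁ x₀ (2 * n)) := by
    rw [altFrom_succ, ← mul_assoc, h₀, add_mul, sub_mul, one_mul, smul_mul_assoc, smul_mul_assoc]
  rw [sub_mul, e1, e2, neg_mul, add_mul, mul_sub, e3, smul_mul_assoc, one_mul, hs, smul_sub]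
  abel

/-- The braid relation may be checked on a vector generating the module. -/
theorem braid_of_apply_eq {V : Type*} [AddCommGroup V] [Module R V] {n : ℕ}
    {x e : Fin 2 → Module.End R V}
    (hsq : ∀ i, x i * x i = 1 - m • x i + (m * l) • e i)
    (hs₀ : altFrom (x 0) (x 1) (2 * n) * e 0 = e 1 * altFrom (x 0) (x 1) (2 * n))
    (hs₁ : e 0 * altFrom (x 1) (x 0) (2 * n) = altFrom (x 1) (x 0) (2 * n) * e 1)
    (v : V) (hv : altFrom (x 0) (x 1) (2 * n + 1) v = altFrom (x 1) (x 0) (2 * n + 1) v)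
    (hgen : ∀ p : Submodule R V, v ∈ p → (∀ i, ∀ w ∈ p, x i w ∈ p) → p = ⊤) :
    altFrom (x 0) (x 1) (2 * n + 1) = altFrom (x 1) (x 0) (2 * n + 1) := by
  have d1 := braid_defect_mul (hsq 0) (hsq 1) hs₁
  have d0 := braid_defect_mul (hsq 1) (hsq 0) hs₀.symm
  rw [← sub_eq_zero, ← LinearMap.ker_eq_top]
  refine hgen _ (by simp [hv]) ?_
  have key : ∀ {D T x : Module.End R V} {w : V}, D * x = T * D → D w = 0 → D (x w) = 0 := by
    intro D T x w h hw
    rw [← Module.End.mul_apply, h, Module.End.mul_apply, hw, map_zero]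
  intro i w hw
  rw [LinearMap.mem_ker] at hw ⊢
  fin_cases i
  · change (altFrom (x 0) (x 1) (2 * n + 1) - altFrom (x 1) (x 0) (2 * n + 1)) (x 0 w) = 0
    rw [← neg_eq_zero, ← LinearMap.neg_apply, neg_sub]
    refine key d0 ?_
    rw [← neg_eq_zero, ← LinearMap.neg_apply, neg_sub]
    exact hw
  · exact key d1 hw

/-- Conjugation by the word `w` of length `2 * n` takes `e₀` to `e₁`, while the hypothesis on `p`
and `q` concerns `w * x₀`. The surplus `x₀` and `y₀` are absorbed by the neighbouring `e₀`, with
factors `l` and `l'` that cancel. -/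
theorem conj_sandwich {x₀ x₁ y₀ y₁ e₀ e₁ p q : A} {n : ℕ} {c l' : R}
    (h₀ : x₀ * y₀ = 1) (h₁ : x₁ * y₁ = 1) (h₀' : y₀ * x₀ = 1) (h₁' : y₁ * x₁ = 1)
    (hs : altFrom x₀ x₁ (2 * n) * e₀ = e₁ * altFrom x₀ x₁ (2 * n))
    (hpq : altFrom x₀ x₁ (2 * n + 1) * q = p * altFrom x₀ x₁ (2 * n + 1))
    (hex : e₀ * x₀ = l • e₀) (hye : y₀ * e₀ = l' • e₀) (hl : l * l' = 1)
    (hq : e₀ * q * e₀ = c • e₀) : e₁ * p * e₁ = c • e₁ := by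
  set w := altFrom x₀ x₁ (2 * n) with hw
  set w' := altFrom y₁ y₀ (2 * n) with hw'
  have hww' : w * w' = 1 := by rw [hw, hw', ← altTo_even_eq, altTo_mul_altFrom h₀ h₁]
  have hw'w : w' * w = 1 := by
    have := altFrom_add_mul_altFrom h₀' h₁' 0 n
    simpa [altFrom] using this
  have he : e₁ = w * e₀ * w' := by rw [hs, mul_assoc, hww', mul_one]
  rw [altFrom_odd, ← hw] at hpq
  have hpw : p * w = w * x₀ * q * y₀ := by
    rw [hpq, mul_assoc, mul_assoc w, h₀, mul_one]
  calc e₁ * p * e₁ = w * e₀ * w' * (p * w) * e₀ * w' := by rw [he]; simp only [mul_assoc]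
    _ = w * (e₀ * ((w' * w) * x₀)) * q * (y₀ * e₀) * w' := by rw [hpw]; simp only [mul_assoc]
    _ = (l * l') • (w * (e₀ * q * e₀) * w') := by
      rw [hw'w, one_mul, hex, hye]
      simp only [mul_smul_comm, smul_mul_assoc, smul_smul, mul_assoc, mul_comm l']
    _ = c • e₁ := by rw [hl, one_smul, hq, he, mul_smul_comm, smul_mul_assoc]

/-- The relations for `e₁` follow from those for `e₀`. -/
theorem Satisfies.of_core {m : R} {l : Rˣ} {τ : R} {n : ℕ} {x y e : Fin 2 → A}
    (x_mul_y : ∀ i, x i * y i = 1) (y_mul_x : ∀ i, y i * x i = 1)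
    (braid : altFrom (x 0) (x 1) (2 * n + 1) = altFrom (x 1) (x 0) (2 * n + 1))
    (skein : ∀ i, x i - y i = m • (e i - 1))
    (x_mul_e : ∀ i, x i * e i = (l : R) • e i) (e_mul_x : ∀ i, e i * x i = (l : R) • e i)
    (e_mul_e : ∀ i, e i * e i = τ • e i)
    (e₀_x_e₀ : ∀ i, 1 ≤ i → i ≤ n →
      e 0 * altFrom (x 1) (x 0) (2 * i - 1) * e 0 = ((l⁻¹ : Rˣ) : R) • e 0)
    (e₀_y_e₀ : ∀ i, 1 ≤ i → i ≤ n →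
      e 0 * altFrom (y 1) (y 0) (2 * i - 1) * e 0 = (l : R) • e 0)
    (slide_e₀ : altFrom (x 0) (x 1) (2 * n) * e 0 = e 1 * altFrom (x 0) (x 1) (2 * n))
    (slide_e₁ : e 0 * altFrom (x 1) (x 0) (2 * n) = altFrom (x 1) (x 0) (2 * n) * e 1) :
    Satisfies m l τ n x y e := by
  have hye : y 0 * e 0 = ((l⁻¹ : Rˣ) : R) • e 0 := by
    have h1 : y 0 * (x 0 * e 0) = e 0 := by rw [← mul_assoc, y_mul_x, one_mul]
    rw [x_mul_e, mul_smul_comm] at h1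
    nth_rewrite 2 [← h1]
    rw [smul_smul, Units.inv_mul, one_smul]
  -- By the braid relation, conjugation by the longest word exchanges `x 0` and `x 1`, hence also `y
  -- 0` and `y 1`.
  set d := altFrom (x 0) (x 1) (2 * n + 1) with hd
  have d1 : d * x 1 = x 0 * d := by
    rw [hd, ← altFrom_even, altFrom_succ, ← braid]
  have d0 : d * x 0 = x 1 * d := by
    rw [braid, ← altFrom_even, altFrom_succ, ← braid]
  have hinv : ∀ {i j}, d * x i = x j * d → d * y i = y j * d := by
    intro i j hij
    calc d * y i = y j * (x j * d) * y i := by rw [← mul_assoc, y_mul_x, one_mul]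
      _ = y j * d := by rw [← hij, mul_assoc, mul_assoc, x_mul_y, mul_one]
  refine ⟨x_mul_y, y_mul_x, braid, skein, x_mul_e, e_mul_x, e_mul_e, e₀_x_e₀, fun i h1 hn => ?_,
    e₀_y_e₀, fun i h1 hn => ?_, slide_e₀, slide_e₁⟩
  · exact conj_sandwich (x_mul_y 0) (x_mul_y 1) (y_mul_x 0) (y_mul_x 1) slide_e₀
      (semiconj_altFrom d1 d0 _) (e_mul_x 0) hye l.mul_inv (e₀_x_e₀ i h1 hn)
  · exact conj_sandwich (x_mul_y 0) (x_mul_y 1) (y_mul_x 0) (y_mul_x 1) slide_e₀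
      (semiconj_altFrom (hinv d1) (hinv d0) _) (e_mul_x 0) hye l.mul_inv (e₀_y_e₀ i h1 hn)

end Braid

/-! ### The chain pattern shared by the cell module and its dual. -/

section Chain

/-- Two operators acting on a sequence of vectors as `x₀, x₁` act on the `[… x₀ x₁]_a e₀`. -/
structure IsChain {K V : Type*} [CommRing K] [AddCommGroup V] [Module K V] (m l : K) (n : ℕ)
    (x₀ x₁ : Module.End K V) (v : ℕ → V) : Prop where
  zero : x₀ (v 0) = l • v 0
  up₀ (k : ℕ) (hk : k < n) : x₀ (v (2 * k + 1)) = v (2 * k + 2)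
  down₀ (k : ℕ) (hk : k < n) :
    x₀ (v (2 * k + 2)) = v (2 * k + 1) + m • v 0 - m • v (2 * k + 2)
  top : x₁ (v (2 * n)) = l • v (2 * n)
  up₁ (k : ℕ) (hk : k < n) : x₁ (v (2 * k)) = v (2 * k + 1)
  down₁ (k : ℕ) (hk : k < n) :
    x₁ (v (2 * k + 1)) = v (2 * k) + (m * l) • v (2 * n) - m • v (2 * k + 1)

namespace IsChain

variable {K V : Type*} [CommRing K] [AddCommGroup V] [Module K V] {m l : K} {n : ℕ}
  {x₀ x₁ : Module.End K V} {v : ℕ → V}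

theorem altTo_zero (h : IsChain m l n x₀ x₁ v) {a : ℕ} (ha : a ≤ 2 * n) :
    altTo x₀ x₁ a (v 0) = v a := by
  induction a with
  | zero => simp [altTo]
  | succ a ih =>
    obtain ⟨k, rfl | rfl⟩ := Nat.even_or_odd' a
    · rw [altTo_odd, Module.End.mul_apply, ih (by omega), h.up₁ k (by omega)]
    · rw [altTo_even, Module.End.mul_apply, ih (by omega), h.up₀ k (by omega)]

/-- Descending from the top of the chain leaves correction terms at the lowest `k` and the highest
`k` odd positions, with opposite signs. For `k = n` these are the same positions and the corrections
cancel. -/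
theorem altTo_top (h : IsChain m l n x₀ x₁ v) {k : ℕ} (hk : k ≤ n) :
    altTo x₁ x₀ (2 * k) (v (2 * n)) = v (2 * (n - k)) +
      m • (∑ i ∈ Finset.range k, v (2 * i + 1) - ∑ i ∈ Finset.range k, v (2 * (n - 1 - i) + 1)) := by
  induction k with
  | zero => simp [altTo]
  | succ k ih =>
    obtain ⟨j, rfl⟩ := Nat.exists_eq_add_of_le' hk
    have s0 : x₀ (v (2 * (j + (k + 1) - k))) = v (2 * j + 1) + m • v 0 - m • v (2 * j + 2) := by
      rw [show 2 * (j + (k + 1) - k) = 2 * j + 2 by omega, h.down₀ j (by omega)]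
    have s1 : ∀ i ∈ Finset.range k, x₀ (v (2 * i + 1)) = v (2 * (i + 1)) := fun i hi =>
      h.up₀ i (by have := Finset.mem_range.1 hi; omega)
    have s2 : ∀ i ∈ Finset.range k, x₀ (v (2 * (j + (k + 1) - 1 - i) + 1)) =
        v (2 * (j + (k + 1) - i)) := fun i hi => by
      have := Finset.mem_range.1 hi
      rw [h.up₀ _ (by omega)]
      congr 1
      omega
    have t1 : x₁ (v (2 * j + 1)) =
        v (2 * j) + (m * l) • v (2 * (j + (k + 1))) - m • v (2 * j + 1) := h.down₁ j (by omega)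
    have t2 : ∀ i ∈ Finset.range (k + 1), x₁ (v (2 * i)) = v (2 * i + 1) := fun i hi =>
      h.up₁ i (by have := Finset.mem_range.1 hi; omega)
    have t3 : ∀ i ∈ Finset.range k, x₁ (v (2 * (j + (k + 1) - (i + 1)))) =
        v (2 * (j + (k + 1) - 1 - i) + 1) := fun i hi => by
      have := Finset.mem_range.1 hi
      rw [h.up₁ _ (by omega)]
      congr 1
      omega
    -- After the half step by `x₀` the corrections sit at even positions; the following `x₁` moves
    -- them to odd ones.
    have step : x₀ (altTo x₁ x₀ (2 * k) (v (2 * (j + (k + 1))))) = v (2 * j + 1) +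
        m • (∑ i ∈ Finset.range (k + 1), v (2 * i) -
          ∑ i ∈ Finset.range (k + 1), v (2 * (j + (k + 1) - i))) := by
      rw [ih (by omega), map_add, s0, map_smul, map_sub, map_sum, map_sum, Finset.sum_congr rfl s1,
        Finset.sum_congr rfl s2, Finset.sum_range_succ' (fun i => v (2 * i)),
        Finset.sum_range_succ (fun i => v (2 * (j + (k + 1) - i))),
        show 2 * (j + (k + 1) - k) = 2 * j + 2 by omega]
      simp only [Nat.mul_zero]
      module
    rw [show 2 * (k + 1) = 2 * k + 2 by ring, altTo_even, altTo_odd, Module.End.mul_apply,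
      Module.End.mul_apply, step, map_add, t1, map_smul, map_sub, map_sum, map_sum,
      Finset.sum_congr rfl t2, Finset.sum_range_succ' (fun i => x₁ (v (2 * (j + (k + 1) - i)))),
      Finset.sum_congr rfl t3,
      Finset.sum_range_succ (fun i => v (2 * (j + (k + 1) - 1 - i) + 1)), Nat.sub_zero, h.top,
      show j + (k + 1) - (k + 1) = j by omega, show j + (k + 1) - 1 - k = j by omega]
    module

theorem altFrom_top (h : IsChain m l n x₀ x₁ v) : altFrom x₁ x₀ (2 * n) (v (2 * n)) = v 0 := by
  rw [← altTo_even_eq, h.altTo_top le_rfl,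
    Finset.sum_range_reflect (fun i => v (2 * i + 1)) n]
  simp

end IsChain

end Chain

/-- The coefficient `c` in `e₀ [y₁ y₀ …]_b [… x₀ x₁]_a e₀ = c e₀`. -/
def gram {K : Type*} [CommRing K] (l : Kˣ) (τ : K) (b a : ℕ) : K :=
  if a = b then τ else if (a + b) % 2 = 0 then 1 else
    if b < a then ((l⁻¹ : Kˣ) : K) else (l : K)

/-! ### The cell module, its pairing, and verification of the relations. -/

section CellModule

variable {K W : Type*} [CommRing K] [AddCommGroup W] [Module K W]

/-- The vector of the standard basis with a given index. -/
def cellVec (K : Type*) [CommRing K] (n a : ℕ) : Fin (2 * n + 1) → K :=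
  if h : a < 2 * n + 1 then Pi.single ⟨a, h⟩ 1 else 0

/-- The linear map with prescribed values on the standard basis. -/
def cellMap (n : ℕ) (w : ℕ → W) : (Fin (2 * n + 1) → K) →ₗ[K] W :=
  (Pi.basisFun K (Fin (2 * n + 1))).constr K (fun i => w i)

theorem cellMap_cellVec {n : ℕ} (w : ℕ → W) {a : ℕ} (ha : a ≤ 2 * n) :
    cellMap n w (cellVec K n a) = w a := by
  rw [cellVec, dif_pos (by omega), cellMap, ← Pi.basisFun_apply, Module.Basis.constr_basis]

theorem cellVec_val {n : ℕ} (i : Fin (2 * n + 1)) : cellVec K n i = Pi.single i 1 := by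
  rw [cellVec, dif_pos i.2]

theorem cell_ext {n : ℕ} {f g : (Fin (2 * n + 1) → K) →ₗ[K] W}
    (h : ∀ a ≤ 2 * n, f (cellVec K n a) = g (cellVec K n a)) : f = g := by
  refine (Pi.basisFun K (Fin (2 * n + 1))).ext fun i => ?_
  rw [Pi.basisFun_apply, ← cellVec_val]
  exact h i (by omega)

theorem cell_ext₀ {n : ℕ} {f g : (Fin (2 * n + 1) → K) →ₗ[K] W}
    (h0 : f (cellVec K n 0) = g (cellVec K n 0))
    (h1 : ∀ k < n, f (cellVec K n (2 * k + 1)) = g (cellVec K n (2 * k + 1)))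
    (h2 : ∀ k < n, f (cellVec K n (2 * k + 2)) = g (cellVec K n (2 * k + 2))) : f = g := by
  refine cell_ext fun a ha => ?_
  obtain ⟨k, rfl | rfl⟩ := Nat.even_or_odd' a
  · rcases k with _ | k
    · exact h0
    · exact h2 k (by omega)
  · exact h1 k (by omega)

theorem cell_ext₁ {n : ℕ} {f g : (Fin (2 * n + 1) → K) →ₗ[K] W}
    (h0 : f (cellVec K n (2 * n)) = g (cellVec K n (2 * n)))
    (h1 : ∀ k < n, f (cellVec K n (2 * k)) = g (cellVec K n (2 * k)))
    (h2 : ∀ k < n, f (cellVec K n (2 * k + 1)) = g (cellVec K n (2 * k + 1))) : f = g := by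
  refine cell_ext fun a ha => ?_
  obtain ⟨k, rfl | rfl⟩ := Nat.even_or_odd' a
  · rcases Nat.lt_or_ge k n with hk | hk
    · exact h1 k hk
    · obtain rfl : k = n := by omega
      exact h0
  · exact h2 k (by omega)

variable (m : K) (l : Kˣ) (τ : K) (n : ℕ)

/-- The functional `v ↦ e₀ [y₁ y₀ …]_b v` on the cell module. -/
def cellForm (b : ℕ) : (Fin (2 * n + 1) → K) →ₗ[K] K :=
  cellMap n (gram l τ b)

/-- The images of the standard basis vectors under `X₀`. -/
def cellX₀Fun (a : ℕ) : Fin (2 * n + 1) → K :=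
  if a = 0 then (l : K) • cellVec K n 0 else if a % 2 = 1 then cellVec K n (a + 1) else
    cellVec K n (a - 1) + m • cellVec K n 0 - m • cellVec K n a

/-- The images of the standard basis vectors under `X₁`. -/
def cellX₁Fun (a : ℕ) : Fin (2 * n + 1) → K :=
  if a = 2 * n then (l : K) • cellVec K n (2 * n) else if a % 2 = 0 then cellVec K n (a + 1) else
    cellVec K n (a - 1) + (m * l) • cellVec K n (2 * n) - m • cellVec K n a

/-- The action of the `X_i` on the cell module. -/
def cellX : Fin 2 → Module.End K (Fin (2 * n + 1) → K) :=
  ![cellMap n (cellX₀Fun m l n), cellMap n (cellX₁Fun m l n)]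

/-- The action of the `E_i` on the cell module. -/
def cellE : Fin 2 → Module.End K (Fin (2 * n + 1) → K) :=
  ![(cellForm l τ n 0).smulRight (cellVec K n 0),
    (cellForm l τ n (2 * n)).smulRight (cellVec K n (2 * n))]

/-- The action of the `X_i⁻¹` on the cell module. -/
def cellY (i : Fin 2) : Module.End K (Fin (2 * n + 1) → K) :=
  cellX m l n i - m • (cellE l τ n i - 1)

variable {l τ n}

theorem gram_self (a : ℕ) : gram l τ a a = τ := by simp [gram]

theorem gram_even {a b : ℕ} (h : a ≠ b) (h' : (a + b) % 2 = 0) : gram l τ b a = 1 := by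
  simp [gram, h, h']

theorem gram_lt {a b : ℕ} (h : b < a) (h' : (a + b) % 2 = 1) :
    gram l τ b a = ((l⁻¹ : Kˣ) : K) := by
  rw [gram, if_neg (by omega), if_neg (by omega), if_pos h]

theorem gram_gt {a b : ℕ} (h : a < b) (h' : (a + b) % 2 = 1) : gram l τ b a = l := by
  rw [gram, if_neg (by omega), if_neg (by omega), if_neg (by omega)]

theorem cellForm_cellVec (b : ℕ) {a : ℕ} (ha : a ≤ 2 * n) :
    cellForm l τ n b (cellVec K n a) = gram l τ b a :=
  cellMap_cellVec _ ha

theorem cellE₀_apply (v : Fin (2 * n + 1) → K) :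
    cellE l τ n 0 v = cellForm l τ n 0 v • cellVec K n 0 := rfl

theorem cellE₁_apply (v : Fin (2 * n + 1) → K) :
    cellE l τ n 1 v = cellForm l τ n (2 * n) v • cellVec K n (2 * n) := rfl

theorem cellY_apply (i : Fin 2) (v : Fin (2 * n + 1) → K) :
    cellY m l τ n i v = cellX m l n i v - m • (cellE l τ n i v - v) := rfl

variable {m}

theorem cellX₀_cellVec {a : ℕ} (ha : a ≤ 2 * n) :
    cellX m l n 0 (cellVec K n a) = cellX₀Fun m l n a :=
  cellMap_cellVec (cellX₀Fun m l n) ha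

theorem cellX₁_cellVec {a : ℕ} (ha : a ≤ 2 * n) :
    cellX m l n 1 (cellVec K n a) = cellX₁Fun m l n a :=
  cellMap_cellVec (cellX₁Fun m l n) ha

/-- The unequal coefficients come from the term `m * l` times `E_i` in `X_i²`: `E₀` takes an odd
basis vector to `l⁻¹` times vector `0`, leaving `m`, whereas `E₁` takes an even one below the top to
the top vector with coefficient `1`, leaving `m * l`. -/
theorem isChain_cellVec :
    IsChain m (l : K) n (cellX m l n 0) (cellX m l n 1) (cellVec K n) := by
  constructor
  · rw [cellX₀_cellVec (by omega), cellX₀Fun, if_pos rfl]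
  · intro k hk
    rw [cellX₀_cellVec (by omega), cellX₀Fun, if_neg (by omega), if_pos (by omega)]
  · intro k hk
    rw [cellX₀_cellVec (by omega), cellX₀Fun, if_neg (by omega), if_neg (by omega)]
    rfl
  · rw [cellX₁_cellVec (by omega), cellX₁Fun, if_pos rfl]
  · intro k hk
    rw [cellX₁_cellVec (by omega), cellX₁Fun, if_neg (by omega), if_pos (by omega)]
  · intro k hk
    rw [cellX₁_cellVec (by omega), cellX₁Fun, if_neg (by omega), if_neg (by omega)]
    rfl

variable (hτ : m * τ = l - ((l⁻¹ : Kˣ) : K) + m)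

include hτ in
theorem cellY₀_zero :
    cellY m l τ n 0 (cellVec K n 0) = ((l⁻¹ : Kˣ) : K) • cellVec K n 0 := by
  rw [cellY_apply, isChain_cellVec.zero, cellE₀_apply, cellForm_cellVec _ (by omega), gram_self,
    smul_sub, smul_smul, hτ]
  module

theorem cellY₀_odd {k : ℕ} (hk : k < n) : cellY m l τ n 0 (cellVec K n (2 * k + 1)) =
    cellVec K n (2 * k + 2) - (m * ((l⁻¹ : Kˣ) : K)) • cellVec K n 0
      + m • cellVec K n (2 * k + 1) := by
  rw [cellY_apply, isChain_cellVec.up₀ k hk, cellE₀_apply, cellForm_cellVec _ (by omega),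
    gram_lt (by omega) (by omega)]
  module

theorem cellY₀_even {k : ℕ} (hk : k < n) : cellY m l τ n 0 (cellVec K n (2 * k + 2)) =
    cellVec K n (2 * k + 1) := by
  rw [cellY_apply, isChain_cellVec.down₀ k hk, cellE₀_apply, cellForm_cellVec _ (by omega),
    gram_even (by omega) (by omega)]
  module

include hτ in
theorem cellY₁_top :
    cellY m l τ n 1 (cellVec K n (2 * n)) = ((l⁻¹ : Kˣ) : K) • cellVec K n (2 * n) := by
  rw [cellY_apply, isChain_cellVec.top, cellE₁_apply, cellForm_cellVec _ (by omega), gram_self,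
    smul_sub, smul_smul, hτ]
  module

theorem cellY₁_even {k : ℕ} (hk : k < n) : cellY m l τ n 1 (cellVec K n (2 * k)) =
    cellVec K n (2 * k + 1) - m • cellVec K n (2 * n) + m • cellVec K n (2 * k) := by
  rw [cellY_apply, isChain_cellVec.up₁ k hk, cellE₁_apply, cellForm_cellVec _ (by omega),
    gram_even (by omega) (by omega)]
  module

theorem cellY₁_odd {k : ℕ} (hk : k < n) : cellY m l τ n 1 (cellVec K n (2 * k + 1)) =
    cellVec K n (2 * k) := by
  rw [cellY_apply, isChain_cellVec.down₁ k hk, cellE₁_apply, cellForm_cellVec _ (by omega),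
    gram_gt (by omega) (by omega)]
  module

include hτ in
theorem cellX_mul_cellY (i : Fin 2) : cellX m l n i * cellY m l τ n i = 1 := by
  fin_cases i
  · refine cell_ext₀ ?_ (fun k hk => ?_) (fun k hk => ?_)
    · change cellX m l n 0 (cellY m l τ n 0 _) = cellVec K n 0
      rw [cellY₀_zero hτ, map_smul, isChain_cellVec.zero, smul_smul, Units.inv_mul, one_smul]
    · change cellX m l n 0 (cellY m l τ n 0 _) = cellVec K n _
      rw [cellY₀_odd hk, map_add, map_sub, map_smul, map_smul, isChain_cellVec.zero,
        isChain_cellVec.up₀ k hk, isChain_cellVec.down₀ k hk, smul_smul, mul_assoc, Units.inv_mul]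
      module
    · change cellX m l n 0 (cellY m l τ n 0 _) = cellVec K n _
      rw [cellY₀_even hk, isChain_cellVec.up₀ k hk]
  · refine cell_ext₁ ?_ (fun k hk => ?_) (fun k hk => ?_)
    · change cellX m l n 1 (cellY m l τ n 1 _) = cellVec K n _
      rw [cellY₁_top hτ, map_smul, isChain_cellVec.top, smul_smul, Units.inv_mul, one_smul]
    · change cellX m l n 1 (cellY m l τ n 1 _) = cellVec K n _
      rw [cellY₁_even hk, map_add, map_sub, map_smul, map_smul, isChain_cellVec.top,
        isChain_cellVec.up₁ k hk, isChain_cellVec.down₁ k hk]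
      module
    · change cellX m l n 1 (cellY m l τ n 1 _) = cellVec K n _
      rw [cellY₁_odd hk, isChain_cellVec.up₁ k hk]

include hτ in
-- With `cellForm_mul_Y₀`, this shows that the rows of the Gram matrix arise from row `0` by
-- applying the inverses alternately, as the meaning of `gram` requires.
theorem cellForm_mul_Y₁ {k : ℕ} (hk : k < n) :
    cellForm l τ n (2 * k) ∘ₗ cellY m l τ n 1 = cellForm l τ n (2 * k + 1) := by
  refine cell_ext₁ ?_ (fun j hj => ?_) (fun j hj => ?_)
  · rw [LinearMap.comp_apply, cellY₁_top hτ, map_smul, cellForm_cellVec _ le_rfl,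
      cellForm_cellVec _ le_rfl, gram_even (by omega) (by omega), gram_lt (by omega) (by omega),
      smul_eq_mul, mul_one]
  · rw [LinearMap.comp_apply, cellY₁_even hj, map_add, map_sub, map_smul, map_smul,
      cellForm_cellVec _ le_rfl, cellForm_cellVec _ (by omega), cellForm_cellVec _ (by omega),
      cellForm_cellVec _ (by omega), gram_even (a := 2 * n) (by omega) (by omega)]
    rcases lt_trichotomy j k with h | rfl | h
    · rw [gram_gt (by omega) (by omega), gram_even (by omega) (by omega),
        gram_gt (by omega) (by omega)]
      ring
    -- On the diagonal the identity is `l⁻¹ - m + m * τ = l`, which is `hτ`.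
    · rw [gram_lt (by omega) (by omega), gram_self, gram_gt (by omega) (by omega), smul_eq_mul,
        smul_eq_mul, hτ]
      ring
    · rw [gram_lt (by omega) (by omega), gram_even (by omega) (by omega),
        gram_lt (by omega) (by omega)]
      ring
  · rw [LinearMap.comp_apply, cellY₁_odd hj, cellForm_cellVec _ (by omega),
      cellForm_cellVec _ (by omega)]
    rcases eq_or_ne j k with rfl | h
    · rw [gram_self, gram_self]
    · rw [gram_even (by omega) (by omega), gram_even (by omega) (by omega)]

include hτ in
theorem cellForm_mul_Y₀ {k : ℕ} (hk : k < n) :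
    cellForm l τ n (2 * k + 1) ∘ₗ cellY m l τ n 0 = cellForm l τ n (2 * k + 2) := by
  refine cell_ext₀ ?_ (fun j hj => ?_) (fun j hj => ?_)
  · rw [LinearMap.comp_apply, cellY₀_zero hτ, map_smul, cellForm_cellVec _ (by omega),
      cellForm_cellVec _ (by omega), gram_gt (by omega) (by omega), gram_even (by omega) (by omega),
      smul_eq_mul, Units.inv_mul]
  · rw [LinearMap.comp_apply, cellY₀_odd hj, map_add, map_sub, map_smul, map_smul,
      cellForm_cellVec _ (by omega), cellForm_cellVec _ (by omega), cellForm_cellVec _ (by omega),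
      cellForm_cellVec _ (by omega), gram_gt (a := 0) (by omega) (by omega), smul_eq_mul,
      smul_eq_mul, mul_assoc, Units.inv_mul]
    rcases lt_trichotomy j k with h | rfl | h
    · rw [gram_gt (by omega) (by omega), gram_even (by omega) (by omega),
        gram_gt (by omega) (by omega)]
      ring
    · rw [gram_lt (by omega) (by omega), gram_self, gram_gt (by omega) (by omega), hτ]
      ring
    · rw [gram_lt (by omega) (by omega), gram_even (by omega) (by omega),
        gram_lt (by omega) (by omega)]
      ring
  · rw [LinearMap.comp_apply, cellY₀_even hj, cellForm_cellVec _ (by omega),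
      cellForm_cellVec _ (by omega)]
    rcases eq_or_ne j k with rfl | h
    · rw [gram_self, gram_self]
    · rw [gram_even (by omega) (by omega), gram_even (by omega) (by omega)]

include hτ in
theorem cellForm_zero_mul_altFrom {b : ℕ} (hb : b ≤ 2 * n) :
    cellForm l τ n 0 ∘ₗ altFrom (cellY m l τ n 1) (cellY m l τ n 0) b = cellForm l τ n b := by
  induction b with
  | zero => rfl
  | succ b ih =>
    obtain ⟨k, rfl | rfl⟩ := Nat.even_or_odd' b
    · rw [altFrom_odd, Module.End.mul_eq_comp, ← LinearMap.comp_assoc, ih (by omega),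
        cellForm_mul_Y₁ hτ (by omega)]
    · rw [altFrom_even, Module.End.mul_eq_comp, ← LinearMap.comp_assoc, ih (by omega),
        cellForm_mul_Y₀ hτ (by omega)]

include hτ in
theorem cellForm_zero_mul_X :
    cellForm l τ n 0 ∘ₗ cellX m l n 0 = (l : K) • cellForm l τ n 0 := by
  refine cell_ext₀ ?_ (fun j hj => ?_) (fun j hj => ?_)
  · rw [LinearMap.comp_apply, isChain_cellVec.zero, map_smul, LinearMap.smul_apply]
  · rw [LinearMap.comp_apply, isChain_cellVec.up₀ j hj, LinearMap.smul_apply,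
      cellForm_cellVec _ (by omega), cellForm_cellVec _ (by omega), gram_even (by omega) (by omega),
      gram_lt (by omega) (by omega), smul_eq_mul, Units.mul_inv]
  · rw [LinearMap.comp_apply, isChain_cellVec.down₀ j hj, LinearMap.smul_apply, map_sub, map_add,
      map_smul, map_smul, cellForm_cellVec _ (by omega), cellForm_cellVec _ (by omega),
      cellForm_cellVec _ (by omega), gram_lt (by omega) (by omega), gram_self,
      gram_even (by omega) (by omega), smul_eq_mul, smul_eq_mul, smul_eq_mul, hτ]
    ring

include hτ in
theorem cellForm_top_mul_X :
    cellForm l τ n (2 * n) ∘ₗ cellX m l n 1 = (l : K) • cellForm l τ n (2 * n) := by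
  refine cell_ext₁ ?_ (fun j hj => ?_) (fun j hj => ?_)
  · rw [LinearMap.comp_apply, isChain_cellVec.top, map_smul, LinearMap.smul_apply]
  · rw [LinearMap.comp_apply, isChain_cellVec.up₁ j hj, LinearMap.smul_apply,
      cellForm_cellVec _ (by omega), cellForm_cellVec _ (by omega), gram_gt (by omega) (by omega),
      gram_even (by omega) (by omega), smul_eq_mul, mul_one]
  · rw [LinearMap.comp_apply, isChain_cellVec.down₁ j hj, LinearMap.smul_apply, map_sub, map_add,
      map_smul, map_smul, cellForm_cellVec _ (by omega), cellForm_cellVec _ (by omega),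
      cellForm_cellVec _ (by omega), gram_even (by omega) (by omega), gram_self,
      gram_gt (by omega) (by omega), smul_eq_mul, smul_eq_mul, smul_eq_mul]
    linear_combination (l : K) * hτ - l.mul_inv

theorem cellX_mul_cellE (i : Fin 2) :
    cellX m l n i * cellE l τ n i = (l : K) • cellE l τ n i := by
  refine LinearMap.ext fun v => ?_
  fin_cases i
  · change cellX m l n 0 (cellE l τ n 0 v) = (l : K) • cellE l τ n 0 v
    rw [cellE₀_apply, map_smul, isChain_cellVec.zero, smul_comm]
  · change cellX m l n 1 (cellE l τ n 1 v) = (l : K) • cellE l τ n 1 v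
    rw [cellE₁_apply, map_smul, isChain_cellVec.top, smul_comm]

include hτ in
theorem cellE_mul_cellX (i : Fin 2) :
    cellE l τ n i * cellX m l n i = (l : K) • cellE l τ n i := by
  refine LinearMap.ext fun v => ?_
  fin_cases i
  · change cellE l τ n 0 (cellX m l n 0 v) = (l : K) • cellE l τ n 0 v
    rw [cellE₀_apply, ← LinearMap.comp_apply, cellForm_zero_mul_X hτ, cellE₀_apply, smul_smul]
    rfl
  · change cellE l τ n 1 (cellX m l n 1 v) = (l : K) • cellE l τ n 1 v
    rw [cellE₁_apply, ← LinearMap.comp_apply, cellForm_top_mul_X hτ, cellE₁_apply, smul_smul]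
    rfl

include hτ in
theorem cellY_mul_cellX (i : Fin 2) : cellY m l τ n i * cellX m l n i = 1 := by
  rw [← cellX_mul_cellY hτ i, cellY, sub_mul, mul_sub, smul_mul_assoc, mul_smul_comm, sub_mul,
    mul_sub, cellX_mul_cellE, cellE_mul_cellX hτ, one_mul, mul_one]

include hτ in
-- The dual module has the same shape: under precomposition the forms, listed backwards, make a
-- chain in which `X₀` and `X₁` exchange roles. `IsChain.altFrom_top` therefore also applies to
-- forms, which is what the second slide relation needs.
theorem isChain_cellForm : IsChain m (l : K) n
    (LinearMap.lcomp K K (cellX m l n 1)) (LinearMap.lcomp K K (cellX m l n 0))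
    (fun a => cellForm l τ n (2 * n - a)) := by
  have hX : ∀ i (f : (Fin (2 * n + 1) → K) →ₗ[K] K), f ∘ₗ cellX m l n i =
      f ∘ₗ cellY m l τ n i + m • (f ∘ₗ cellE l τ n i) - m • f := by
    intro i f
    refine LinearMap.ext fun v => ?_
    simp only [LinearMap.comp_apply, LinearMap.add_apply, LinearMap.sub_apply,
      LinearMap.smul_apply, cellY_apply, map_sub, map_smul, smul_sub]
    abel
  have hE0 : ∀ f : (Fin (2 * n + 1) → K) →ₗ[K] K,
      f ∘ₗ cellE l τ n 0 = f (cellVec K n 0) • cellForm l τ n 0 := by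
    intro f
    refine LinearMap.ext fun v => ?_
    simp [cellE₀_apply, mul_comm]
  have hE1 : ∀ f : (Fin (2 * n + 1) → K) →ₗ[K] K,
      f ∘ₗ cellE l τ n 1 = f (cellVec K n (2 * n)) • cellForm l τ n (2 * n) := by
    intro f
    refine LinearMap.ext fun v => ?_
    simp [cellE₁_apply, mul_comm]
  have hYX : ∀ i (f : (Fin (2 * n + 1) → K) →ₗ[K] K),
      (f ∘ₗ cellY m l τ n i) ∘ₗ cellX m l n i = f := by
    intro i f
    rw [LinearMap.comp_assoc, ← Module.End.mul_eq_comp, cellY_mul_cellX hτ]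
    rfl
  constructor
  · exact cellForm_top_mul_X hτ
  · intro k hk
    obtain ⟨j, rfl⟩ := Nat.exists_eq_add_of_lt hk
    change cellForm l τ _ (2 * (k + j + 1) - (2 * k + 1)) ∘ₗ cellX m l _ 1 =
      cellForm l τ _ (2 * (k + j + 1) - (2 * k + 2))
    rw [show 2 * (k + j + 1) - (2 * k + 1) = 2 * j + 1 by omega,
      show 2 * (k + j + 1) - (2 * k + 2) = 2 * j by omega, ← cellForm_mul_Y₁ hτ (by omega), hYX]
  · intro k hk
    obtain ⟨j, rfl⟩ := Nat.exists_eq_add_of_lt hk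
    change cellForm l τ _ (2 * (k + j + 1) - (2 * k + 2)) ∘ₗ cellX m l _ 1 =
      cellForm l τ _ (2 * (k + j + 1) - (2 * k + 1)) + m • cellForm l τ _ (2 * (k + j + 1))
        - m • cellForm l τ _ (2 * (k + j + 1) - (2 * k + 2))
    rw [show 2 * (k + j + 1) - (2 * k + 1) = 2 * j + 1 by omega,
      show 2 * (k + j + 1) - (2 * k + 2) = 2 * j by omega, hX, cellForm_mul_Y₁ hτ (by omega), hE1,
      cellForm_cellVec _ le_rfl, gram_even (by omega) (by omega), one_smul]
  · change cellForm l τ n (2 * n - 2 * n) ∘ₗ cellX m l n 0 =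
      (l : K) • cellForm l τ n (2 * n - 2 * n)
    rw [Nat.sub_self, cellForm_zero_mul_X hτ]
  · intro k hk
    obtain ⟨j, rfl⟩ := Nat.exists_eq_add_of_lt hk
    change cellForm l τ _ (2 * (k + j + 1) - 2 * k) ∘ₗ cellX m l _ 0 =
      cellForm l τ _ (2 * (k + j + 1) - (2 * k + 1))
    rw [show 2 * (k + j + 1) - (2 * k + 1) = 2 * j + 1 by omega,
      show 2 * (k + j + 1) - 2 * k = 2 * j + 2 by omega, ← cellForm_mul_Y₀ hτ (by omega), hYX]
  · intro k hk
    obtain ⟨j, rfl⟩ := Nat.exists_eq_add_of_lt hk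
    change cellForm l τ _ (2 * (k + j + 1) - (2 * k + 1)) ∘ₗ cellX m l _ 0 =
      cellForm l τ _ (2 * (k + j + 1) - 2 * k) + (m * l) •
        cellForm l τ _ (2 * (k + j + 1) - 2 * (k + j + 1))
        - m • cellForm l τ _ (2 * (k + j + 1) - (2 * k + 1))
    rw [show 2 * (k + j + 1) - (2 * k + 1) = 2 * j + 1 by omega,
      show 2 * (k + j + 1) - 2 * k = 2 * j + 2 by omega, Nat.sub_self, hX,
      cellForm_mul_Y₀ hτ (by omega), hE0, cellForm_cellVec _ (by omega),
      gram_gt (by omega) (by omega), smul_smul]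

theorem altFrom_lcomp {V : Type*} [AddCommGroup V] [Module K V] (a b : Module.End K V) (k : ℕ)
    (f : V →ₗ[K] K) : altFrom (LinearMap.lcomp K K a : Module.End K (V →ₗ[K] K))
      (LinearMap.lcomp K K b : Module.End K (V →ₗ[K] K)) k f = f ∘ₗ altTo b a k := by
  induction k generalizing a b with
  | zero => rfl
  | succ k ih => rw [altFrom_succ, Module.End.mul_apply, ih, altTo_succ]; rfl

include hτ in
theorem cellForm_zero_mul_altFrom_X :
    cellForm l τ n 0 ∘ₗ altFrom (cellX m l n 1) (cellX m l n 0) (2 * n) =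
      cellForm l τ n (2 * n) := by
  have h := (isChain_cellForm (n := n) hτ).altFrom_top
  rw [altFrom_lcomp, altTo_even_eq] at h
  simpa using h

include hτ in
theorem satisfies_cell :
    Satisfies m l τ n (cellX m l n) (cellY m l τ n) (cellE l τ n) := by
  have hw : altFrom (cellX m l n 0) (cellX m l n 1) (2 * n) (cellVec K n 0) =
      cellVec K n (2 * n) := by
    rw [← altTo_even_eq, isChain_cellVec.altTo_zero le_rfl]
  have hww : altFrom (cellY m l τ n 1) (cellY m l τ n 0) (2 * n) *
      altFrom (cellX m l n 0) (cellX m l n 1) (2 * n) = 1 := by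
    have := altFrom_add_mul_altFrom (cellY_mul_cellX (n := n) hτ 0) (cellY_mul_cellX hτ 1) 0 n
    simpa [altFrom] using this
  have slide₀ : altFrom (cellX m l n 0) (cellX m l n 1) (2 * n) * cellE l τ n 0 =
      cellE l τ n 1 * altFrom (cellX m l n 0) (cellX m l n 1) (2 * n) := by
    refine LinearMap.ext fun v => ?_
    rw [Module.End.mul_apply, Module.End.mul_apply, cellE₀_apply, cellE₁_apply, map_smul, hw,
      ← cellForm_zero_mul_altFrom hτ le_rfl, LinearMap.comp_apply, ← Module.End.mul_apply, hww]
    rfl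
  have slide₁ : cellE l τ n 0 * altFrom (cellX m l n 1) (cellX m l n 0) (2 * n) =
      altFrom (cellX m l n 1) (cellX m l n 0) (2 * n) * cellE l τ n 1 := by
    refine LinearMap.ext fun v => ?_
    rw [Module.End.mul_apply, Module.End.mul_apply, cellE₀_apply, cellE₁_apply, map_smul,
      isChain_cellVec.altFrom_top, ← LinearMap.comp_apply, cellForm_zero_mul_altFrom_X hτ]
  have hsq : ∀ i, cellX m l n i * cellX m l n i =
      1 - m • cellX m l n i + (m * l) • cellE l τ n i := by
    intro i
    rw [← cellX_mul_cellY hτ i, cellY, mul_sub, mul_smul_comm, mul_sub, cellX_mul_cellE, mul_one,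
      smul_sub, smul_smul]
    abel
  refine Satisfies.of_core (cellX_mul_cellY hτ) (cellY_mul_cellX hτ) ?_ ?_ cellX_mul_cellE
    (cellE_mul_cellX hτ) ?_ ?_ ?_ slide₀ slide₁
  -- Both braid words send vector `0` to `l` times the top vector, and the upward steps of the chain
  -- generate the module from vector `0`.
  · refine braid_of_apply_eq hsq slide₀ slide₁ (cellVec K n 0) ?_ ?_
    · rw [altFrom_odd, Module.End.mul_apply, isChain_cellVec.zero, map_smul, hw, altFrom_succ,
        Module.End.mul_apply, hw, isChain_cellVec.top]
    · intro p h0 hp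
      have hv : ∀ a ≤ 2 * n, cellVec K n a ∈ p := by
        intro a
        induction a with
        | zero => exact fun _ => h0
        | succ a ih =>
          intro ha
          obtain ⟨k, rfl | rfl⟩ := Nat.even_or_odd' a
          · rw [← isChain_cellVec (m := m) (l := l).up₁ k (by omega)]
            exact hp 1 _ (ih (by omega))
          · change cellVec K n (2 * k + 2) ∈ p
            rw [← isChain_cellVec (m := m) (l := l).up₀ k (by omega)]
            exact hp 0 _ (ih (by omega))
      rw [← Submodule.ker_mkQ p, LinearMap.ker_eq_top]
      exact cell_ext fun a ha => by simpa using hv a ha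
  · intro i
    rw [cellY, sub_sub_cancel]
  · intro i
    refine LinearMap.ext fun v => ?_
    fin_cases i
    · change cellE l τ n 0 (cellE l τ n 0 v) = τ • cellE l τ n 0 v
      rw [cellE₀_apply, cellE₀_apply v, map_smul, cellForm_cellVec _ (by omega), gram_self,
        smul_smul, smul_eq_mul, mul_comm τ]
    · change cellE l τ n 1 (cellE l τ n 1 v) = τ • cellE l τ n 1 v
      rw [cellE₁_apply, cellE₁_apply v, map_smul, cellForm_cellVec _ le_rfl, gram_self,
        smul_smul, smul_eq_mul, mul_comm τ]
  · intro i h1 hn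
    obtain ⟨k, rfl⟩ := Nat.exists_eq_add_of_le' h1
    refine LinearMap.ext fun v => ?_
    rw [show 2 * (k + 1) - 1 = 2 * k + 1 by omega, ← altTo_odd_eq, Module.End.mul_apply,
      Module.End.mul_apply, LinearMap.smul_apply, cellE₀_apply, cellE₀_apply v, map_smul,
      isChain_cellVec.altTo_zero (by omega), map_smul, cellForm_cellVec _ (by omega),
      gram_lt (by omega) (by omega), smul_assoc, smul_comm]
  · intro i h1 hn
    obtain ⟨k, rfl⟩ := Nat.exists_eq_add_of_le' h1
    refine LinearMap.ext fun v => ?_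
    rw [show 2 * (k + 1) - 1 = 2 * k + 1 by omega, Module.End.mul_apply,
      Module.End.mul_apply, LinearMap.smul_apply, cellE₀_apply, cellE₀_apply v, map_smul, map_smul,
      ← LinearMap.comp_apply, cellForm_zero_mul_altFrom hτ (by omega),
      cellForm_cellVec _ (by omega), gram_gt (by omega) (by omega), smul_assoc, smul_comm]

end CellModule

/-! ### The regular module of the Hecke algebra, where the `E_i` act by zero. -/

section HeckeModule

variable {K : Type*} [CommRing K] (m : K) (n : ℕ)

/-- The basis vector `[X₁ X₀ …]_k` of the regular module of the Hecke algebra. -/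
def heckeL (K : Type*) [CommRing K] (n k : ℕ) : Fin (2 * n + 1) ⊕ Fin (2 * n + 1) → K :=
  if h : k < 2 * n + 1 then Pi.single (Sum.inl ⟨k, h⟩) 1 else Pi.single (Sum.inr (Fin.last _)) 1

/-- The basis vector `[X₀ X₁ …]_k` of the regular module of the Hecke algebra. -/
def heckeR (K : Type*) [CommRing K] (n : ℕ) : ℕ → Fin (2 * n + 1) ⊕ Fin (2 * n + 1) → K
  | 0 => Pi.single (Sum.inl 0) 1
  | k + 1 => if h : k < 2 * n + 1 then Pi.single (Sum.inr ⟨k, h⟩) 1 else 0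

/-- The images of the basis vectors under `X₀`. -/
def heckeX₀Fun : Fin (2 * n + 1) ⊕ Fin (2 * n + 1) → (Fin (2 * n + 1) ⊕ Fin (2 * n + 1) → K)
  | Sum.inl i => heckeR K n (i + 1)
  | Sum.inr j => heckeL K n j - m • heckeR K n (j + 1)

/-- The images of the basis vectors under `X₁`. -/
def heckeX₁Fun : Fin (2 * n + 1) ⊕ Fin (2 * n + 1) → (Fin (2 * n + 1) ⊕ Fin (2 * n + 1) → K)
  | Sum.inl i => if (i : ℕ) = 0 then heckeL K n 1 else heckeR K n (i - 1) - m • heckeL K n i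
  | Sum.inr j => if (j : ℕ) = 2 * n then heckeR K n (2 * n) - m • heckeL K n (2 * n + 1) else
      heckeL K n (j + 2)

/-- The action of the `X_i` on the regular module of the Hecke algebra. -/
def heckeX : Fin 2 → Module.End K (Fin (2 * n + 1) ⊕ Fin (2 * n + 1) → K) :=
  ![(Pi.basisFun K _).constr K (heckeX₀Fun m n), (Pi.basisFun K _).constr K (heckeX₁Fun m n)]

variable {n}

theorem heckeL_of_le {k : ℕ} (h : k ≤ 2 * n) :
    heckeL K n k = Pi.single (Sum.inl ⟨k, by omega⟩) 1 := by
  rw [heckeL, dif_pos (by omega)]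

theorem heckeR_of_le {k : ℕ} (h : k ≤ 2 * n) :
    heckeR K n (k + 1) = Pi.single (Sum.inr ⟨k, by omega⟩) 1 := by
  rw [heckeR, dif_pos (by omega)]

/-- The two longest words share one basis vector; the out-of-range value in `heckeL` is chosen for
this. -/
theorem heckeL_last : heckeL K n (2 * n + 1) = heckeR K n (2 * n + 1) := by
  rw [heckeL, dif_neg (by omega), heckeR_of_le le_rfl]
  rfl

theorem heckeL_zero : heckeL K n 0 = heckeR K n 0 := by
  rw [heckeL_of_le (by omega)]
  rfl

theorem heckeX₀_single (i : Fin (2 * n + 1) ⊕ Fin (2 * n + 1)) :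
    heckeX m n 0 (Pi.single i 1) = heckeX₀Fun m n i := by
  change (Pi.basisFun K _).constr K (heckeX₀Fun m n) _ = _
  rw [← Pi.basisFun_apply, Module.Basis.constr_basis]

theorem heckeX₁_single (i : Fin (2 * n + 1) ⊕ Fin (2 * n + 1)) :
    heckeX m n 1 (Pi.single i 1) = heckeX₁Fun m n i := by
  change (Pi.basisFun K _).constr K (heckeX₁Fun m n) _ = _
  rw [← Pi.basisFun_apply, Module.Basis.constr_basis]

theorem heckeX₀_L {k : ℕ} (h : k ≤ 2 * n) :
    heckeX m n 0 (heckeL K n k) = heckeR K n (k + 1) := by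
  rw [heckeL_of_le h, heckeX₀_single, heckeX₀Fun]

theorem heckeX₀_R {k : ℕ} (h : k ≤ 2 * n) :
    heckeX m n 0 (heckeR K n (k + 1)) = heckeL K n k - m • heckeR K n (k + 1) := by
  rw [heckeR_of_le h, heckeX₀_single, heckeX₀Fun, heckeR_of_le h]

theorem heckeX₁_R {k : ℕ} (h : k ≤ 2 * n) :
    heckeX m n 1 (heckeR K n k) = heckeL K n (k + 1) := by
  rcases k with _ | k
  · rw [heckeR, heckeX₁_single, heckeX₁Fun, if_pos (by simp)]
  · rw [heckeR_of_le (by omega), heckeX₁_single, heckeX₁Fun, if_neg (by simp; omega)]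

theorem heckeX₁_L {k : ℕ} (h : k ≤ 2 * n) :
    heckeX m n 1 (heckeL K n (k + 1)) = heckeR K n k - m • heckeL K n (k + 1) := by
  rcases Nat.lt_or_ge k (2 * n) with hk | hk
  · rw [heckeL_of_le (by omega), heckeX₁_single, heckeX₁Fun, if_neg (by simp), heckeL_of_le hk]
    rfl
  · obtain rfl : k = 2 * n := by omega
    rw [heckeL_last, heckeR_of_le le_rfl, heckeX₁_single, heckeX₁Fun, if_pos rfl, heckeL_last,
      heckeR_of_le le_rfl]

theorem hecke_ext₀ {W : Type*} [AddCommGroup W] [Module K W]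
    {f g : (Fin (2 * n + 1) ⊕ Fin (2 * n + 1) → K) →ₗ[K] W}
    (hL : ∀ k ≤ 2 * n, f (heckeL K n k) = g (heckeL K n k))
    (hR : ∀ k ≤ 2 * n, f (heckeR K n (k + 1)) = g (heckeR K n (k + 1))) : f = g := by
  refine (Pi.basisFun K _).ext fun i => ?_
  rw [Pi.basisFun_apply]
  rcases i with i | j
  · simpa only [heckeL_of_le (show (i : ℕ) ≤ 2 * n by omega)] using hL i (by omega)
  · simpa only [heckeR_of_le (show (j : ℕ) ≤ 2 * n by omega)] using hR j (by omega)

/-- The basis splits into pairs in two ways: `X₀` pairs `heckeL k` with `heckeR (k + 1)`, and `X₁`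
pairs `heckeR k` with `heckeL (k + 1)`. Each extensionality lemma follows the pairing of one
generator. -/
theorem hecke_ext₁ {W : Type*} [AddCommGroup W] [Module K W]
    {f g : (Fin (2 * n + 1) ⊕ Fin (2 * n + 1) → K) →ₗ[K] W}
    (hR : ∀ k ≤ 2 * n, f (heckeR K n k) = g (heckeR K n k))
    (hL : ∀ k ≤ 2 * n, f (heckeL K n (k + 1)) = g (heckeL K n (k + 1))) : f = g := by
  refine hecke_ext₀ (fun k hk => ?_) (fun k hk => ?_)
  · rcases k with _ | k
    · rw [heckeL_zero]
      exact hR 0 hk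
    · exact hL k (by omega)
  · rcases Nat.lt_or_ge k (2 * n) with hk' | hk'
    · exact hR (k + 1) hk'
    · obtain rfl : k = 2 * n := by omega
      rw [← heckeL_last]
      exact hL _ le_rfl

theorem heckeX_sq (i : Fin 2) : heckeX m n i * heckeX m n i = 1 - m • heckeX m n i := by
  fin_cases i
  · refine hecke_ext₀ (fun k hk => ?_) (fun k hk => ?_)
    · change heckeX m n 0 (heckeX m n 0 _) = heckeL K n k - m • heckeX m n 0 _
      rw [heckeX₀_L m hk, heckeX₀_R m hk]
    · change heckeX m n 0 (heckeX m n 0 _) = heckeR K n (k + 1) - m • heckeX m n 0 _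
      rw [heckeX₀_R m hk, map_sub, map_smul, heckeX₀_L m hk, heckeX₀_R m hk]
  · refine hecke_ext₁ (fun k hk => ?_) (fun k hk => ?_)
    · change heckeX m n 1 (heckeX m n 1 _) = heckeR K n k - m • heckeX m n 1 _
      rw [heckeX₁_R m hk, heckeX₁_L m hk]
    · change heckeX m n 1 (heckeX m n 1 _) = heckeL K n (k + 1) - m • heckeX m n 1 _
      rw [heckeX₁_L m hk, map_sub, map_smul, heckeX₁_R m hk, heckeX₁_L m hk]

theorem altFrom_heckeX {k : ℕ} (hk : k ≤ 2 * n + 1) :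
    altFrom (heckeX m n 1) (heckeX m n 0) k (heckeL K n 0) = heckeL K n k ∧
      altFrom (heckeX m n 0) (heckeX m n 1) k (heckeL K n 0) = heckeR K n k := by
  induction k with
  | zero => exact ⟨rfl, heckeL_zero⟩
  | succ k ih =>
    obtain ⟨h1, h2⟩ := ih (by omega)
    rw [altFrom_succ, altFrom_succ, Module.End.mul_apply, Module.End.mul_apply, h1, h2,
      heckeX₁_R m (by omega), heckeX₀_L m (by omega)]
    exact ⟨rfl, rfl⟩

theorem satisfies_hecke (l : Kˣ) (τ : K) : Satisfies m l τ n (heckeX m n)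
    (fun i => heckeX m n i + m • 1) (fun _ => 0) := by
  refine ⟨fun i => ?_, fun i => ?_, ?_, fun i => ?_, ?_, ?_, ?_, ?_, ?_, ?_, ?_, ?_, ?_⟩
  · rw [mul_add, heckeX_sq, mul_smul_comm, mul_one, sub_add_cancel]
  · rw [add_mul, heckeX_sq, smul_mul_assoc, one_mul, sub_add_cancel]
  -- With `e = 0` the slide conditions are trivial and the `m * l` term vanishes, so any value may
  -- stand for `l`.
  · refine braid_of_apply_eq (m := m) (l := 0) (e := fun _ => 0) (fun i => by simp [heckeX_sq])
      (by simp) (by simp) (heckeL K n 0) ?_ ?_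
    · rw [(altFrom_heckeX m le_rfl).1, (altFrom_heckeX m le_rfl).2, heckeL_last]
    · intro p h0 hp
      have key : ∀ k ≤ 2 * n + 1, heckeL K n k ∈ p ∧ heckeR K n k ∈ p := by
        intro k
        induction k with
        | zero => exact fun _ => ⟨h0, heckeL_zero (K := K) (n := n) ▸ h0⟩
        | succ k ih =>
          intro hk
          obtain ⟨h1, h2⟩ := ih (by omega)
          rw [← heckeX₁_R m (by omega), ← heckeX₀_L m (by omega)]
          exact ⟨hp 1 _ h2, hp 0 _ h1⟩
      rw [← Submodule.ker_mkQ p, LinearMap.ker_eq_top]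
      exact hecke_ext₀ (fun k hk => by simpa using (key k (by omega)).1)
        (fun k hk => by simpa using (key (k + 1) (by omega)).2)
  all_goals simp

end HeckeModule

/-! ### Linear independence of `Σ` when the Gram matrix is invertible. -/

section Independence

/-- The matrix of the pairing between the right and the left cell. -/
def gramMatrix {K : Type*} [CommRing K] (l : Kˣ) (τ : K) (n : ℕ) :
    Matrix (Fin (2 * n + 1)) (Fin (2 * n + 1)) K :=
  Matrix.of fun b a => gram l τ b a

variable {K : Type*} [CommRing K] {m : K} {l : Kˣ} {τ : K} {n : ℕ}

theorem cellForm_eq_mulVec (b : Fin (2 * n + 1)) (v : Fin (2 * n + 1) → K) :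
    cellForm l τ n b v = (gramMatrix l τ n).mulVec v b := by
  rw [cellForm, cellMap, Module.Basis.constr_apply_fintype]
  simp [Matrix.mulVec, dotProduct, gramMatrix, mul_comm]

/-- The cell contains every rank one map "form `b` times vector `a`". The forms are the rows of the
invertible Gram matrix, so they span the dual, and these maps span all endomorphisms. -/
theorem twoSidedCell_cell_eq_top (hτ : m * τ = l - ((l⁻¹ : Kˣ) : K) + m)
    (hG : IsUnit (gramMatrix l τ n).det) :
    twoSidedCell K n (cellX m l n) (cellE l τ n) = ⊤ := by
  have h := satisfies_cell (n := n) hτ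
  have hy : ∀ j, ∀ z ∈ rightCell K n (cellX m l n) (cellE l τ n),
      z * cellY m l τ n j ∈ rightCell K n (cellX m l n) (cellE l τ n) :=
    fun j z hz => h.mul_y_mem_rightCell j hz
  have key : ∀ a b : Fin (2 * n + 1), (cellForm l τ n b).smulRight (Pi.single a 1) ∈
      twoSidedCell K n (cellX m l n) (cellE l τ n) := by
    intro a b
    -- Form `b` is exactly `e 0` followed by a word in the inverses; stability of the right cell
    -- rewrites this through words in the `x j`.
    have hmem := Satisfies.altTo_mul_mem_twoSidedCell (show (a : ℕ) ≤ 2 * n by omega)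
      (Satisfies.mul_altFrom_mem (hy 1) (hy 0) b Satisfies.e₀_mem_rightCell)
    convert hmem using 1
    refine LinearMap.ext fun v => ?_
    rw [Module.End.mul_apply, Module.End.mul_apply, cellE₀_apply, map_smul,
      isChain_cellVec.altTo_zero (by omega), ← LinearMap.comp_apply,
      cellForm_zero_mul_altFrom hτ (by omega), cellVec_val]
    rfl
  refine eq_top_iff.2 fun T _ => ?_
  set G := gramMatrix l τ n with hGdef
  -- Since `T v = S (G v)` and the coordinates of `G v` are the forms evaluated at `v`, the matrix
  -- entries of `S` are the required coefficients.
  set S := T ∘ₗ Matrix.toLin' G⁻¹ with hS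
  have hT : T = ∑ b, ∑ a, S (Pi.single b 1) a • (cellForm l τ n b).smulRight (Pi.single a 1) := by
    refine LinearMap.ext fun v => ?_
    have h1 : T v = S (G.mulVec v) := by
      rw [hS, LinearMap.comp_apply, Matrix.toLin'_apply, Matrix.mulVec_mulVec,
        Matrix.nonsing_inv_mul _ hG, Matrix.one_mulVec]
    rw [h1, LinearMap.pi_apply_eq_sum_univ S, LinearMap.sum_apply]
    refine Finset.sum_congr rfl fun b _ => ?_
    rw [← cellForm_eq_mulVec, LinearMap.sum_apply]
    have h2 : (fun j => if b = j then (1 : K) else 0) = Pi.single b 1 := by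
      funext j
      simp [Pi.single_apply, eq_comm]
    rw [h2]
    funext c
    simp [Pi.single_apply, mul_comm]
  rw [hT]
  exact Submodule.sum_mem _ fun b _ => Submodule.sum_mem _ fun a _ => Submodule.smul_mem _ _ (key a b)

theorem map_sigmaOf {A C F : Type*} [Monoid A] [Monoid C] [FunLike F A C] [MonoidHomClass F A C]
    (f : F) (n : ℕ) (x e : Fin 2 → A) (i : SigmaIdx n) :
    f (sigmaOf n x e i) = sigmaOf n (fun i => f (x i)) (fun i => f (e i)) i := by
  rcases i with (i | j) | ⟨a, b⟩
  · exact map_altFrom f _ _ _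
  · exact map_altFrom f _ _ _
  · simp only [sigmaOf, map_mul, map_altFrom, map_altTo]

theorem Satisfies.sum_sigmaOf_eq_zero {A : Type*} [Ring A] [Algebra K A] {x y e : Fin 2 → A}
    (h : Satisfies m l τ n x y e) {c : SigmaIdx n → K}
    (hc : ∑ i, c i • sigmaOf n (fun i => gen m l τ n (Gen.X i))
      (fun i => gen m l τ n (Gen.E i)) i = 0) : ∑ i, c i • sigmaOf n x e i = 0 := by
  obtain ⟨f, hf⟩ := h.exists_algHom
  rw [← map_zero f, ← hc, map_sum]
  refine Finset.sum_congr rfl fun i _ => ?_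
  rw [map_smul, map_sigmaOf]
  simp only [hf]
  rfl

theorem Satisfies.coeff_inr_eq_zero {A : Type*} [Ring A] [Algebra K A] {x y e : Fin 2 → A}
    (h : Satisfies m l τ n x y e)
    (hli : LinearIndependent K (fun p => sigmaOf n x e (Sum.inr p))) {c : SigmaIdx n → K}
    (hc : ∑ i, c i • sigmaOf n (fun i => gen m l τ n (Gen.X i))
      (fun i => gen m l τ n (Gen.E i)) i = 0) (hc0 : ∀ i, c (Sum.inl i) = 0) :
    ∀ p, c (Sum.inr p) = 0 := by
  have h1 := h.sum_sigmaOf_eq_zero hc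
  rw [Fintype.sum_sum_type] at h1
  simp only [hc0, zero_smul, Finset.sum_const_zero, zero_add] at h1
  exact Fintype.linearIndependent_iff.1 hli (fun p => c (Sum.inr p)) h1

theorem linearIndependent_cell {K : Type*} [Field K] {m : K} {l : Kˣ} {τ : K}
    (hτ : m * τ = l - ((l⁻¹ : Kˣ) : K) + m) (hG : IsUnit (gramMatrix l τ n).det) :
    LinearIndependent K (fun p : Fin (2 * n + 1) × Fin (2 * n + 1) =>
      sigmaOf n (cellX m l n) (cellE l τ n) (Sum.inr p)) := by
  refine linearIndependent_of_top_le_span_of_card_eq_finrank ?_ ?_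
  · rw [← twoSidedCell_cell_eq_top hτ hG]
    refine Submodule.span_mono ?_
    rintro _ ⟨a, ha, b, hb, rfl⟩
    exact ⟨(⟨a, by omega⟩, ⟨b, by omega⟩), rfl⟩
  · rw [Module.finrank_linearMap]
    simp

theorem linearIndependent_sigmaOf {K : Type*} [Field K] {m : K} {l : Kˣ} {τ : K}
    (hτ : m * τ = l - ((l⁻¹ : Kˣ) : K) + m) (hG : IsUnit (gramMatrix l τ n).det) :
    LinearIndependent K (sigmaOf n (fun i => gen m l τ n (Gen.X i))
      (fun i => gen m l τ n (Gen.E i))) := by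
  rw [Fintype.linearIndependent_iff]
  intro c hc
  -- Evaluating at the vector `1` of the Hecke module removes the terms with `E₀` and turns the
  -- words into the standard basis.
  have hc0 : ∀ i, c (Sum.inl i) = 0 := by
    have h1 := LinearMap.congr_fun ((satisfies_hecke (n := n) m l τ).sum_sigmaOf_eq_zero hc)
      (heckeL K n 0)
    rw [Fintype.sum_sum_type, LinearMap.add_apply, LinearMap.sum_apply, LinearMap.sum_apply] at h1
    simp only [LinearMap.smul_apply] at h1
    have h2 : ∀ i, sigmaOf n (heckeX m n) (fun _ => 0) (Sum.inl i) (heckeL K n 0) =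
        Pi.single i 1 := by
      rintro (i | j)
      · exact (altFrom_heckeX m (by omega)).1.trans (heckeL_of_le (by omega))
      · exact (altFrom_heckeX m (by omega)).2.trans (heckeR_of_le (by omega))
    have h3 : ∀ p, sigmaOf n (heckeX m n) (fun _ => 0) (Sum.inr p) = 0 := by
      rintro ⟨a, b⟩
      simp [sigmaOf]
    intro i
    simp only [h2, h3, LinearMap.zero_apply, smul_zero, Finset.sum_const_zero, add_zero] at h1
    have h4 := congrFun h1 i
    rw [Finset.sum_apply, Finset.sum_eq_single i (fun j _ hj => by simp [hj.symm])
      (fun h => absurd (Finset.mem_univ i) h)] at h4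
    simpa using h4
  have hc1 : ∀ p, c (Sum.inr p) = 0 :=
    (satisfies_cell hτ).coeff_inr_eq_zero (linearIndependent_cell hτ hG) hc hc0
  rintro (i | p)
  · exact hc0 i
  · exact hc1 p

end Independence

/-! ### Invertibility of the Gram matrix over the field of fractions. -/

section Generic

theorem algebraMap_mLam_mul_tau : algebraMap Lam FLam mLam * tau =
    (Units.map (algebraMap Lam FLam) lLam : FLamˣ) -
      ((Units.map (algebraMap Lam FLam) lLam)⁻¹ : FLamˣ) + algebraMap Lam FLam mLam := by
  have hm : algebraMap Lam FLam mLam ≠ 0 := by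
    rw [Ne, map_eq_zero_iff _ (IsFractionRing.injective Lam FLam)]
    intro h
    have := congrArg (LaurentPolynomial.eval₂ (Polynomial.evalRingHom (1 : ℚ)) 1) h
    simp [mLam] at this
  rw [← map_inv, tau, mul_add, mul_div_cancel₀ _ hm, mul_one]
  rfl

/-- The specialization `m = 0`, `l = 2` of `Λ`. -/
def specialize : Lam →+* ℚ :=
  LaurentPolynomial.eval₂ (Polynomial.evalRingHom 0) (Units.mk0 2 two_ne_zero)

theorem specialize_mLam : specialize mLam = 0 := by
  simp [specialize, mLam]

theorem specialize_lLam : specialize (lLam : Lam) = 2 ∧ specialize ((lLam⁻¹ : Lamˣ) : Lam) = 2⁻¹ := by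
  have h1 : specialize (lLam : Lam) = 2 := by
    change specialize (LaurentPolynomial.T 1) = 2
    simp [specialize]
  refine ⟨h1, ?_⟩
  refine eq_inv_of_mul_eq_one_left ?_
  rw [← h1, ← map_mul, Units.inv_mul, map_one]

theorem isUnit_det_gramMatrix (n : ℕ) :
    IsUnit (gramMatrix (Units.map (algebraMap Lam FLam) lLam) tau n).det := by
  set G' : Matrix (Fin (2 * n + 1)) (Fin (2 * n + 1)) Lam := Matrix.of fun b a =>
    if a = b then (lLam : Lam) - ((lLam⁻¹ : Lamˣ) : Lam) + mLam else mLam * gram lLam 0 b a with hG'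
  have h1 : (algebraMap Lam FLam).mapMatrix G' = algebraMap Lam FLam mLam •
      gramMatrix (Units.map (algebraMap Lam FLam) lLam) tau n := by
    ext b a
    rw [RingHom.mapMatrix_apply, Matrix.map_apply, Matrix.smul_apply, hG', Matrix.of_apply,
      gramMatrix, Matrix.of_apply, smul_eq_mul]
    split_ifs with hab
    · rw [hab, gram_self, algebraMap_mLam_mul_tau, map_add, map_sub, ← map_inv]
      rfl
    · have hab' : (a : ℕ) ≠ b := fun h => hab (Fin.ext h)
      rw [map_mul, gram, gram, if_neg hab', if_neg hab', ← map_inv]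
      congr 1
      split_ifs
      · exact map_one _
      · rfl
      · rfl
  -- Off-diagonal entries carry a factor `m` and vanish; the diagonal becomes `2 - 1/2`.
  have h2 : specialize.mapMatrix G' = (3 / 2 : ℚ) • 1 := by
    ext b a
    rw [RingHom.mapMatrix_apply, Matrix.map_apply, Matrix.smul_apply, hG', Matrix.of_apply,
      Matrix.one_apply]
    split_ifs with hab hba hba
    · rw [map_add, map_sub, specialize_lLam.1, specialize_lLam.2, specialize_mLam]
      norm_num
    · exact absurd hab.symm hba
    · exact absurd hba.symm hab
    · rw [map_mul, specialize_mLam]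
      simp
  have h3 : G'.det ≠ 0 := by
    intro h
    have := RingHom.map_det specialize G'
    rw [h2, h, map_zero, Matrix.det_smul, Matrix.det_one, mul_one] at this
    exact pow_ne_zero _ (by norm_num) this.symm
  refine isUnit_iff_ne_zero.2 fun h => h3 ?_
  have := RingHom.map_det (algebraMap Lam FLam) G'
  rw [h1, Matrix.det_smul, h, mul_zero] at this
  exact (map_eq_zero_iff _ (IsFractionRing.injective Lam FLam)).1 this

end Generic

end DihedralBMW

end

/-! ### Comparison of the integral form with the algebra over the field. -/

open DihedralBMW in
theorem mainTheorem3 (n : ℕ) (hn : 1 ≤ n)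
    (R : Subalgebra DihedralBMW.Lam DihedralBMW.FLam) (hτ : DihedralBMW.tau ∈ R) :
    -- `Σ` is a basis of the algebra over the field, with structure constants in `R`,
    (∃ b : Module.Basis (DihedralBMW.SigmaIdx n) DihedralBMW.FLam (DihedralBMW.B n),
      (∀ i, b i = DihedralBMW.sigma n i) ∧ ∀ i j k, b.repr (b i * b j) k ∈ R) ∧
    -- the span `A_n` of `Σ` is an `R`-algebra, naturally isomorphic to the integral form,
    (∃ A : Subalgebra R (DihedralBMW.B n),
      Subalgebra.toSubmodule A = DihedralBMW.An R n ∧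
      ∃ e : DihedralBMW.BBar R hτ n ≃ₐ[R] A,
        ∀ g : DihedralBMW.Gen,
          (e (DihedralBMW.bBarGen R hτ n g) : DihedralBMW.B n) = DihedralBMW.bGen n g) ∧
    -- and the integral form is free of the stated rank.
    Module.Free R (DihedralBMW.BBar R hτ n) ∧
    Module.Finite R (DihedralBMW.BBar R hτ n) ∧
    Module.finrank R (DihedralBMW.BBar R hτ n) = 2 * (2 * n + 1) + (2 * n + 1) ^ 2 := by
  have hsigma : sigma n =
      sigmaOf n (fun i => bGen n (Gen.X i)) (fun i => bGen n (Gen.E i)) := by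
    funext i
    rcases i with (i | j) | ⟨a, b⟩ <;> rfl
  have hli : LinearIndependent FLam (sigma n) := by
    rw [hsigma]
    exact linearIndependent_sigmaOf algebraMap_mLam_mul_tau (isUnit_det_gramMatrix n)
  have hspan : ⊤ ≤ Submodule.span FLam (Set.range (sigma n)) := by
    rw [hsigma]
    exact (span_sigmaOf_gen_eq_top _ _ _ n).ge
  have hsat : Satisfies (algebraMap Lam R mLam) (Units.map (algebraMap Lam R) lLam) ⟨tau, hτ⟩ n
      (fun i => bGen n (Gen.X i)) (fun i => bGen n (Gen.Xinv i)) (fun i => bGen n (Gen.E i)) := by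
    refine Satisfies.map_smul_tower (R := FLam) ?_
    exact satisfies_gen _ _ _ n
  obtain ⟨f, hf⟩ := hsat.exists_algHom
  have hfgen : ∀ g, f (bBarGen R hτ n g) = bGen n g := by
    intro g
    refine (hf g).trans ?_
    cases g <;> rfl
  set s : SigmaIdx n → BBar R hτ n :=
    sigmaOf n (fun i => bBarGen R hτ n (Gen.X i)) (fun i => bBarGen R hτ n (Gen.E i)) with hs
  have hfs : ∀ i, f (s i) = sigma n i := by
    intro i
    rw [hs, map_sigmaOf, hsigma]
    simp only [hfgen]
  have hsspan : Submodule.span R (Set.range s) = ⊤ := span_sigmaOf_gen_eq_top _ _ _ n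
  have hliR : LinearIndependent R (sigma n) := hli.restrict_scalars' R
  have hfsli : LinearIndependent R (f.toLinearMap ∘ s) := by
    have : f.toLinearMap ∘ s = sigma n := funext hfs
    rw [this]
    exact hliR
  -- A relation among the `s i` would map to one in `Σ`, so this spanning family of the integral
  -- form is a basis.
  have hsli : LinearIndependent R s := LinearIndependent.of_comp f.toLinearMap hfsli
  let bs : Module.Basis (SigmaIdx n) R (BBar R hτ n) := Module.Basis.mk hsli hsspan.ge
  have hinj : Function.Injective f :=
    LinearMap.injective_of_linearIndependent (f := f.toLinearMap) hsspan hfsli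
  have hrange : Subalgebra.toSubmodule f.range = An R n := by
    have : Subalgebra.toSubmodule f.range = Submodule.map f.toLinearMap ⊤ := by
      rw [Submodule.map_top]
      rfl
    rw [this, ← hsspan, Submodule.map_span, An, ← Set.range_comp]
    congr 2
    funext i
    exact hfs i
  refine ⟨⟨Module.Basis.mk hli hspan, fun i => Module.Basis.mk_apply hli hspan i, ?_⟩,
    ⟨f.range, hrange, AlgEquiv.ofInjective f hinj, hfgen⟩, Module.Free.of_basis bs,
    Module.Finite.of_basis bs, ?_⟩
  · intro i j k
    -- The range of `f` is a subalgebra equal to the `R`-span of `Σ`, so products of elements of `Σ`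
    -- have coordinates in `R`.
    have hmem : ∀ i, sigma n i ∈ f.range := fun i => ⟨s i, hfs i⟩
    have hprod : Module.Basis.mk hli hspan i * Module.Basis.mk hli hspan j ∈
        Submodule.span R (Set.range (Module.Basis.mk hli hspan)) := by
      rw [Module.Basis.coe_mk]
      have := f.range.mul_mem (hmem i) (hmem j)
      rwa [← Subalgebra.mem_toSubmodule, hrange] at this
    obtain ⟨r, hr⟩ := (Module.Basis.mem_span_iff_repr_mem R _ _).1 hprod k
    rw [← hr]
    exact r.2
  · rw [Module.finrank_eq_card_basis bs]
    simp
    ring
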